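/- Let $X_1,X_2,\dots$ be i.i.d. random vectors in $[0,1]^2$ having a density $f$ with $a\le f\le b$ on $[0,1]^2$ for some constants $0<a\le b<\infty$. For each full sample size $N$ let $n=n(N)$ be the subsample size and $q=q(N)$ the number of levels, where, as $N\to\infty$, $n\to\infty$, $n=O(N^{\nu})$ for some fixed $\nu\in(0,1)$, and $n-\lambda q^2=O(q)$ for some fixed positive integer $\lambda$. Divide $[0,1]$ into $q$ intervals of equal length. For a subsample $\mathcal X^*$ of size $n$ drawn without replacement from $\{X_1,\dots,X_N\}$, let $z_i\in\{0,\dots,q-1\}^2$ record the intervals containing the two coordinates of its $i$-th point, let $\delta(z_i,z_{i'})$ be the number of coordinates in which $z_i$ and $z_{i'}$ agree, and put $L(\mathcal X^*)=\sum_{i<i'}\delta(z_i,z_{i'})^2$. An IES subsample $\{(x^*_{i1},x^*_{i2})\}_{i=1}^n$ is any minimizer of $L$ among all subsamples of size $n$. Let $K$ be a symmetric probability density vanishing outside $[-1,1]$ and Lipschitz continuous on $[-1,1]$, and let $h_1,h_2>0$ be bandwidths, depending on $N$, with $h_t\to0$ and $1/(qh_t^2)\to0$ for $t=1,2$. Let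 $\mathcal S_t$ be the $n\times n$ local linear smoother matrix $$[\mathcal S_t]_{ij}=\frac{1}{nh_t}K\Big(\frac{x^*_{jt}-x^*_{it}}{h_t}\Big)\frac{V_{2}(x^*_{it})-(x^*_{jt}-x^*_{it})V_{1}(x^*_{it})}{V_{0}(x^*_{it})V_{2}(x^*_{it})-V_{1}(x^*_{it})^2},\qquad V_{r}(x)=\frac1n\sum_{i=1}^n\frac1{h_t}K\Big(\frac{x^*_{it}-x}{h_t}\Big)(x^*_{it}-x)^r,$$ and $\mathcal S_t^*=(\mathcal I-\mathbf 1\mathbf 1^T/n)\mathcal S_t$ its centred version. Write $\|A\|_\infty=\max_i\sum_j|A_{ij}|$. Then, as $N\to\infty$, for every choice of the IES subsample: 1. with probability tending to one the denominators in $\mathcal S_1$ and $\mathcal S_2$ are nonzero, so that both matrices are well defined; 2. $\|\mathcal S_1^*\mathcal S_2^*\|_\infty=o_p(1)$ and $\|\mathcal S_2^*\mathcal S_1^*\|_\infty=o_p(1)$; 3. with probability tending to one, for every response vector $y\in\mathbb R^n$, the backfitting estimating equations $m_1+\mathcal S_1^*m_2=\mathcal S_1^*y$, $\mathcal S_2^*m_1+m_2=\mathcal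 S_2^*y$ of the bivariate additive model have a unique solution $(m_1,m_2)$, and the backfitting algorithm $m_1\leftarrow\mathcal S_1^*(y-\bar y\mathbf 1-m_2)$, $m_2\leftarrow\mathcal S_2^*(y-\bar y\mathbf 1-m_1)$ (iterated, each update using the latest values) converges to it from every starting point. -/

import Mathlib

open MeasureTheory ProbabilityTheory Filter Topology
open scoped NNReal ENNReal

noncomputable section

namespace IES

/-! Independence-encouraging subsampling: the full data are `x 0, …, x (N-1)`, with
`x k : Fin p → ℝ` taking values in the unit cube. -/

/-- The level in `{0, …, q-1}` of `u ∈ [0,1]` when `[0,1]` is cut into `q` intervals of equal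
length: `[k/q, (k+1)/q)` has level `k`, and the last interval also contains `1`. -/
def level (q : ℕ) (u : ℝ) : ℕ := min ⌊(q : ℝ) * u⌋₊ (q - 1)

/-- The number of coordinates in which two points have the same level. -/
def coincidences {p : ℕ} (q : ℕ) (u v : Fin p → ℝ) : ℕ :=
  (Finset.univ.filter fun j => level q (u j) = level q (v j)).card

/-- The loss `L = ∑_{i < i'} δ(z_i, z_{i'})²` of a sample of size `n`, where `z_i` is the `i`-th row
of its membership matrix and `δ` counts coincidences. -/
def loss {p n : ℕ} (q : ℕ) (u : Fin n → Fin p → ℝ) : ℕ :=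
  ∑ i, ∑ i' ∈ Finset.Ioi i, coincidences q (u i) (u i') ^ 2

/-- `s` lists the indices of a subsample of size `n` (without replacement) of the full data
`x 0, …, x (N-1)`. -/
def IsSubsample {n : ℕ} (N : ℕ) (s : Fin n → ℕ) : Prop :=
  Function.Injective s ∧ ∀ i, s i < N

/-- `s` is an IES subsample: it minimizes the loss among all subsamples of size `n`. -/
def IsIESSubsample {p n : ℕ} (q N : ℕ) (x : ℕ → Fin p → ℝ) (s : Fin n → ℕ) : Prop :=
  IsSubsample N s ∧
    ∀ s' : Fin n → ℕ, IsSubsample N s' → loss q (fun i => x (s i)) ≤ loss q (fun i => x (s' i))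

/-! Local linear smoothing at the design points `u 0, …, u (n-1)`. -/

/-- `V_t(z) = n⁻¹ ∑ᵢ h⁻¹ K((uᵢ - z)/h) (uᵢ - z)^t`. -/
def moment {n : ℕ} (K : ℝ → ℝ) (h : ℝ) (u : Fin n → ℝ) (t : ℕ) (z : ℝ) : ℝ :=
  (1 / (n : ℝ)) * ∑ i, (1 / h) * K ((u i - z) / h) * (u i - z) ^ t

/-- The determinant `V₀ V₂ - V₁²` of the weighted normal equations of the local linear fit
at `z`. -/
def localDet {n : ℕ} (K : ℝ → ℝ) (h : ℝ) (u : Fin n → ℝ) (z : ℝ) : ℝ :=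
  moment K h u 0 z * moment K h u 2 z - moment K h u 1 z ^ 2

/-- The local linear smoother matrix: `(S y)ᵢ` is the intercept at `uᵢ` of the weighted
least squares line through the `(uⱼ, yⱼ)` with weights `K((uⱼ - uᵢ)/h)`. (Meaningful when
`localDet K h u (u i) ≠ 0` for all `i`.) -/
def smoother {n : ℕ} (K : ℝ → ℝ) (h : ℝ) (u : Fin n → ℝ) : Matrix (Fin n) (Fin n) ℝ :=
  Matrix.of fun i j =>
    (1 / ((n : ℝ) * h)) * K ((u j - u i) / h) *
      (moment K h u 2 (u i) - (u j - u i) * moment K h u 1 (u i)) / localDet K h u (u i)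

/-- The centred matrix `(I - 𝟏𝟏ᵀ/n) S`. -/
def centred {n : ℕ} (S : Matrix (Fin n) (Fin n) ℝ) : Matrix (Fin n) (Fin n) ℝ :=
  (1 - (1 / (n : ℝ)) • Matrix.of fun _ _ => (1 : ℝ)) * S

section Norm

attribute [local instance] Matrix.linftyOpNormedAddCommGroup

/-- `‖A‖_∞ = maxᵢ ∑ⱼ |Aᵢⱼ|`, the maximal absolute row sum. -/
def rowSumNorm {n : ℕ} (A : Matrix (Fin n) (Fin n) ℝ) : ℝ := ‖A‖

end Norm

/-! Backfitting of the bivariate additive model with centred smoother matrices `A₁, A₂` and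
response vector `y`; `m = (m₁, m₂)` are the vectors of fitted component values. -/

/-- The backfitting estimating equations `m₁ + A₁ m₂ = A₁ y`, `A₂ m₁ + m₂ = A₂ y`. -/
def SolvesEstimatingEquations {n : ℕ} (A₁ A₂ : Matrix (Fin n) (Fin n) ℝ) (y : Fin n → ℝ)
    (m : (Fin n → ℝ) × (Fin n → ℝ)) : Prop :=
  m.1 + A₁.mulVec m.2 = A₁.mulVec y ∧ A₂.mulVec m.1 + m.2 = A₂.mulVec y

/-- The residuals `y - ȳ` after fitting the intercept `α̂ = ȳ`. -/
def subMean {n : ℕ} (y : Fin n → ℝ) : Fin n → ℝ := fun i => y i - (1 / (n : ℝ)) * ∑ j, y j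

/-- One cycle of backfitting: `m₁ ← A₁ (y - ȳ - m₂)`, then `m₂ ← A₂ (y - ȳ - m₁)` with the
updated `m₁`. -/
def backfitStep {n : ℕ} (A₁ A₂ : Matrix (Fin n) (Fin n) ℝ) (y : Fin n → ℝ)
    (m : (Fin n → ℝ) × (Fin n → ℝ)) : (Fin n → ℝ) × (Fin n → ℝ) :=
  (A₁.mulVec (subMean y - m.2),
    A₂.mulVec (subMean y - A₁.mulVec (subMean y - m.2)))

/-- For every response vector the estimating equations have a unique solution, and backfitting
converges to it from every starting point. -/
def BackfittingConverges {n : ℕ} (A₁ A₂ : Matrix (Fin n) (Fin n) ℝ) : Prop :=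
  ∀ y : Fin n → ℝ, ∃ m : (Fin n → ℝ) × (Fin n → ℝ),
    (∀ m', SolvesEstimatingEquations A₁ A₂ y m' ↔ m' = m) ∧
      ∀ m₀, Tendsto (fun r : ℕ => (backfitStep A₁ A₂ y)^[r] m₀) atTop (𝓝 m)

/-- `S_t*`: the centred local linear smoother matrix in the predictor `t` on the subsample `s` of
the bivariate data `x`. -/
def centredSmoother {n : ℕ} (K : ℝ → ℝ) (h : ℝ) (x : ℕ → Fin 2 → ℝ) (s : Fin n → ℕ) (t : Fin 2) :
    Matrix (Fin n) (Fin n) ℝ :=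
  centred (smoother K h fun i => x (s i) t)

end IES

end

noncomputable section

namespace IES

/-! ### Loss and cell counts -/

/-! For two coordinates the squared coincidence number of a pair is [same row] + [same column] + 2
[same cell]. Hence the loss is, up to terms fixed by n and q, the total squared deviation of row
counts, column counts and (twice) cell counts from the targets λq, λq and λ (`loss_eq_deviation`). A
sample that fills the grid diagonal by diagonal has deviation O(q), because n = λq² + O(q). When the
data contain such a sample, any minimizer does at least as well. Its cell deviations are integers,
so |k| ≤ k² turns the squared bound into Σ |count - λ| = O(q) over all q² cells
(`sum_abs_cellCount_sub_le`).

The data contain such a sample as soon as each cell holds λ + 1 points. The density is at least a,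
so a cell is missed by a block of N/(λ+1) points with probability at most exp(-cN/q²). Since q² =
O(N^ν) with ν < 1, a union bound over O(q²) events tends to 0 (`tendsto_measure_not_isRich`). The
rest is deterministic.

Summing over rows or columns, each marginal design is uniform up to O(q) points out of about λq².
Hence the scaled local determinants are bounded below, rows of the smoothers have bounded ℓ¹ norm
and sum to 1, and weights are constant on levels up to an ℓ¹ error O(1/(qh))
(`exists_isRegularSmoother`). The difference of two rows of S₁ is therefore nearly a function E of
the first level with total nearly 0, and the rows of S₂ nearly a function F of the second level. As
cells are nearly equally filled, Σ_k E F is nearly λ (Σ E)(Σ F), which is nearly 0. So all rows of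
S₁S₂ agree up to O(1/(qh₁) + 1/(qh₂)) (`sum_abs_mul_sub_mul_le`). Centring removes the common row:
S₁*S₂* is the centred S₁S₂, and its norm is at most the largest ℓ¹ distance between rows.

A full backfitting cycle acts on m₂ as an affine map with linear part S₂*S₁*. Once its norm is below
1 the contraction principle gives existence, uniqueness and convergence
(`backfittingConverges_of_rowSumNorm_lt`). -/

/-- Number of points whose coordinate `t` has level `c`. -/
def levelCount {n : ℕ} (q : ℕ) (w : Fin n → ℝ) (c : ℕ) : ℕ :=
  (Finset.univ.filter fun i => level q (w i) = c).card

/-- Number of points in the cell `c` of the grid. -/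
def cellCount {n : ℕ} (q : ℕ) (u : Fin n → Fin 2 → ℝ) (c : ℕ × ℕ) : ℕ :=
  (Finset.univ.filter fun i => (level q (u i 0), level q (u i 1)) = c).card

theorem level_lt {q : ℕ} (hq : 0 < q) (w : ℝ) : level q w < q := by
  unfold level; omega

theorem sum_ite_eq_sum_card_sq {ι κ : Type*} [Fintype ι] [DecidableEq κ] (g : ι → κ)
    (T : Finset κ) (hT : ∀ i, g i ∈ T) :
    ∑ i, ∑ i', (if g i = g i' then 1 else 0) =
      ∑ c ∈ T, (Finset.univ.filter fun i => g i = c).card ^ 2 := by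
  rw [← Finset.sum_fiberwise_of_maps_to (t := T) (g := g) fun i _ => hT i]
  refine Finset.sum_congr rfl fun c _ => ?_
  rw [sq, ← smul_eq_mul, ← Finset.sum_const]
  refine Finset.sum_congr rfl fun i hi => ?_
  rw [Finset.card_filter]
  simp [(Finset.mem_filter.1 hi).2, eq_comm]

/-- With two coordinates δ² is [rows agree] + [columns agree] + 2 [both agree], and the number of
ordered pairs in a common class is the sum of squared class sizes. The 4n comes from the diagonal
pairs, for which δ = 2. -/
theorem two_mul_loss_add {n q : ℕ} (hq : 0 < q) (u : Fin n → Fin 2 → ℝ) :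
    2 * loss q u + 4 * n =
      ∑ c ∈ Finset.range q, levelCount q (fun i => u i 0) c ^ 2 +
      ∑ c ∈ Finset.range q, levelCount q (fun i => u i 1) c ^ 2 +
      2 * ∑ c ∈ Finset.range q ×ˢ Finset.range q, cellCount q u c ^ 2 := by
  unfold levelCount cellCount
  rw [← sum_ite_eq_sum_card_sq (fun i => level q (u i 0)) _
      fun i => Finset.mem_range.2 (level_lt hq _),
    ← sum_ite_eq_sum_card_sq (fun i => level q (u i 1)) _
      fun i => Finset.mem_range.2 (level_lt hq _),
    ← sum_ite_eq_sum_card_sq (fun i => (level q (u i 0), level q (u i 1))) _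
      fun i => Finset.mem_product.2
        ⟨Finset.mem_range.2 (level_lt hq _), Finset.mem_range.2 (level_lt hq _)⟩]
  have hF : ∀ i i', coincidences q (u i) (u i') ^ 2 =
      (if level q (u i 0) = level q (u i' 0) then 1 else 0) +
      (if level q (u i 1) = level q (u i' 1) then 1 else 0) +
      2 * (if (level q (u i 0), level q (u i 1)) = (level q (u i' 0), level q (u i' 1))
        then 1 else 0) := by
    intro i i'
    unfold coincidences
    rw [Finset.card_filter, Fin.sum_univ_two]
    by_cases h0 : level q (u i 0) = level q (u i' 0) <;>
      by_cases h1 : level q (u i 1) = level q (u i' 1) <;> simp [h0, h1]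
  have hdiag : ∑ i, coincidences q (u i) (u i) ^ 2 = 4 * n := by
    simp [hF]; ring
  have hsym : ∀ i i', coincidences q (u i) (u i') ^ 2 = coincidences q (u i') (u i) ^ 2 := by
    intro i i'; unfold coincidences; simp only [eq_comm]
  have htot : ∑ i, ∑ i', coincidences q (u i) (u i') ^ 2 = 2 * loss q u + 4 * n := by
    rw [← hdiag]
    have hsplit : ∀ i, ∑ i', coincidences q (u i) (u i') ^ 2 =
        ∑ i' ∈ Finset.Ioi i, coincidences q (u i) (u i') ^ 2 +
        ∑ i' ∈ Finset.Iio i, coincidences q (u i) (u i') ^ 2 + coincidences q (u i) (u i) ^ 2 := by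
      intro i
      rw [← Finset.sum_filter_add_sum_filter_not Finset.univ (fun i' => i < i'),
        ← Finset.sum_filter_add_sum_filter_not (Finset.univ.filter fun i' => ¬ i < i')
          (fun i' => i' < i), add_assoc]
      congr 1
      · congr 1; ext; simp
      · congr 1
        · congr 1; ext; simp; exact le_of_lt
        · rw [← Finset.sum_singleton (fun i' => coincidences q (u i) (u i') ^ 2) i]
          congr 1; ext x; simp; exact ⟨fun h => le_antisymm h.1 h.2, fun h => by simp [h]⟩
    simp_rw [hsplit, Finset.sum_add_distrib]
    congr 1
    rw [two_mul]
    congr 1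
    unfold loss
    rw [Finset.sum_sigma', Finset.sum_sigma']
    refine Finset.sum_nbij' (fun x => ⟨x.2, x.1⟩) (fun x => ⟨x.2, x.1⟩) ?_ ?_ ?_ ?_ ?_ <;>
      simp +contextual [hsym]
  rw [← htot]
  simp_rw [hF, Finset.sum_add_distrib, Finset.mul_sum]

/-! ### A balanced design -/

/-- Each block of m consecutive indices takes the value c exactly once, and n indices consist of n /
m full blocks and at most one partial block. -/
theorem card_filter_block {κ : Type*} [DecidableEq κ] {n m : ℕ} (g : ℕ → κ) (c : κ)
    (hm : 0 < m) (hex : ∀ s, ∃ i, i / m = s ∧ g i = c)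
    (huniq : ∀ i i', i / m = i' / m → g i = c → g i' = c → i = i') :
    n / m ≤ (Finset.univ.filter fun i : Fin n => g i = c).card ∧
      (Finset.univ.filter fun i : Fin n => g i = c).card ≤ n / m + 1 := by
  constructor
  · conv_lhs => rw [← Finset.card_range (n / m)]
    refine Finset.card_le_card_of_surjOn (fun i : Fin n => (i : ℕ) / m) ?_
    intro s hs
    obtain ⟨i, hi, hg⟩ := hex s
    have hs' : s < n / m := by simpa using hs
    have : i < n := (Nat.div_lt_iff_lt_mul hm).1 (hi ▸ hs') |>.trans_le (Nat.div_mul_le_self n m)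
    exact ⟨⟨i, this⟩, by simpa using hg, hi⟩
  · conv_rhs => rw [← Finset.card_range (n / m + 1)]
    refine Finset.card_le_card_of_injOn (fun i : Fin n => (i : ℕ) / m) ?_ ?_
    · intro i _
      simpa [Nat.lt_succ_iff] using Nat.div_le_div_right i.2.le
    · intro i hi i' hi' h
      exact Fin.ext (huniq i i' h (by simpa using hi) (by simpa using hi'))

/-- The cells filled one after the other along the diagonals of the `q × q` grid. -/
def diagonalCell (q i : ℕ) : ℕ × ℕ := (i % q, (i % q + i / q) % q)

theorem exists_add_mod_eq {q b : ℕ} (hb : b < q) (s : ℕ) : ∃ x < q, (x + s) % q = b := by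
  have hq : 0 < q := by omega
  refine ⟨(b + (q - s % q)) % q, Nat.mod_lt _ hq, ?_⟩
  have h1 : s % q < q := Nat.mod_lt _ hq
  have h2 : b + (q - s % q) + s = b + q * (s / q + 1) := by
    have := Nat.mod_add_div s q
    rw [mul_add]; omega
  rw [Nat.mod_add_mod, h2, Nat.add_mul_mod_self_left, Nat.mod_eq_of_lt hb]

theorem eq_of_add_mod_eq {q x x' s : ℕ} (hx : x < q) (hx' : x' < q)
    (h : (x + s) % q = (x' + s) % q) : x = x' := by
  have : x ≡ x' [MOD q] := Nat.ModEq.add_right_cancel' s h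
  rwa [Nat.ModEq, Nat.mod_eq_of_lt hx, Nat.mod_eq_of_lt hx'] at this

theorem eq_of_mod_eq_of_div_eq {q i i' : ℕ} (h : i % q = i' % q) (h' : i / q = i' / q) : i = i' := by
  rw [← Nat.mod_add_div i q, ← Nat.mod_add_div i' q, h, h']

theorem diagonalCell_fst_card {n q c : ℕ} (hc : c < q) :
    n / q ≤ (Finset.univ.filter fun i : Fin n => (diagonalCell q i).1 = c).card ∧
      (Finset.univ.filter fun i : Fin n => (diagonalCell q i).1 = c).card ≤ n / q + 1 := by
  refine card_filter_block (fun i => (diagonalCell q i).1) c (by omega) (fun s => ⟨c + q * s, ?_, ?_⟩) ?_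
  · rw [Nat.add_mul_div_left _ _ (by omega), Nat.div_eq_of_lt hc, zero_add]
  · simp [diagonalCell, Nat.mod_eq_of_lt hc]
  · intro i i' h h1 h2
    exact eq_of_mod_eq_of_div_eq (h1.trans h2.symm) h

theorem diagonalCell_snd_card {n q c : ℕ} (hc : c < q) :
    n / q ≤ (Finset.univ.filter fun i : Fin n => (diagonalCell q i).2 = c).card ∧
      (Finset.univ.filter fun i : Fin n => (diagonalCell q i).2 = c).card ≤ n / q + 1 := by
  have hq : 0 < q := by omega
  refine card_filter_block (fun i => (diagonalCell q i).2) c hq (fun s => ?_) ?_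
  · obtain ⟨x, hx, hxs⟩ := exists_add_mod_eq hc s
    refine ⟨x + q * s, ?_, ?_⟩
    · rw [Nat.add_mul_div_left _ _ hq, Nat.div_eq_of_lt hx, zero_add]
    · simp only [diagonalCell, Nat.add_mul_mod_self_left, Nat.mod_eq_of_lt hx,
        Nat.add_mul_div_left _ _ hq, Nat.div_eq_of_lt hx, zero_add, hxs]
  · intro i i' h h1 h2
    refine eq_of_mod_eq_of_div_eq ?_ h
    have h3 := h1.trans h2.symm
    simp only [diagonalCell, h] at h3
    exact eq_of_add_mod_eq (Nat.mod_lt _ hq) (Nat.mod_lt _ hq) h3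

/-- The first coordinate of the cell gives i mod q, and the difference of the coordinates gives (i /
q) mod q; the block number supplies the rest of i. -/
theorem eq_of_diagonalCell_eq {q i i' : ℕ} (hq : 0 < q) (h : i / (q * q) = i' / (q * q))
    (h' : diagonalCell q i = diagonalCell q i') : i = i' := by
  simp only [diagonalCell, Prod.mk.injEq] at h'
  obtain ⟨h1, h2⟩ := h'
  refine eq_of_mod_eq_of_div_eq h1 (eq_of_mod_eq_of_div_eq (q := q) ?_ ?_)
  · rw [h1, Nat.add_mod _ (i / q), Nat.add_mod _ (i' / q), add_comm (_ % q % q), add_comm (_ % q % q)] at h2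
    exact eq_of_add_mod_eq (Nat.mod_lt _ hq) (Nat.mod_lt _ hq) h2
  · rwa [Nat.div_div_eq_div_mul, Nat.div_div_eq_div_mul]

/-- During a block of q² indices the shift i / q runs through all residues mod q, and the q shifted
diagonals partition the grid. -/
theorem diagonalCell_card {n q : ℕ} {c : ℕ × ℕ} (hc : c.1 < q) (hc' : c.2 < q) :
    n / (q * q) ≤ (Finset.univ.filter fun i : Fin n => diagonalCell q i = c).card ∧
      (Finset.univ.filter fun i : Fin n => diagonalCell q i = c).card ≤ n / (q * q) + 1 := by
  have hq : 0 < q := by omega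
  refine card_filter_block (diagonalCell q) c (by positivity) (fun s => ?_) ?_
  · obtain ⟨t, ht, hts⟩ := exists_add_mod_eq hc' c.1
    have h1 : (c.1 + q * (t + q * s)) / q = t + q * s := by
      rw [Nat.add_mul_div_left _ _ hq, Nat.div_eq_of_lt hc, zero_add]
    refine ⟨c.1 + q * (t + q * s), ?_, ?_⟩
    · rw [← Nat.div_div_eq_div_mul, h1, Nat.add_mul_div_left _ _ hq, Nat.div_eq_of_lt ht, zero_add]
    · ext
      · simp [diagonalCell, Nat.mod_eq_of_lt hc]
      · simp only [diagonalCell, h1, Nat.add_mul_mod_self_left, Nat.mod_eq_of_lt hc]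
        rw [← add_assoc, Nat.add_mul_mod_self_left, add_comm, hts]
  · intro i i' h h1 h2
    exact eq_of_diagonalCell_eq hq h (h1.trans h2.symm)

/-! ### Cell counts of minimizers of the loss -/

theorem sum_levelCount {n q : ℕ} (hq : 0 < q) (w : Fin n → ℝ) :
    ∑ c ∈ Finset.range q, levelCount q w c = n := by
  unfold levelCount
  rw [← Finset.card_eq_sum_card_fiberwise fun i _ => Finset.mem_coe.2 (Finset.mem_range.2 (level_lt hq (w i)))]
  simp

theorem sum_cellCount {n q : ℕ} (hq : 0 < q) (u : Fin n → Fin 2 → ℝ) :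
    ∑ c ∈ Finset.range q ×ˢ Finset.range q, cellCount q u c = n := by
  unfold cellCount
  rw [← Finset.card_eq_sum_card_fiberwise fun i _ => Finset.mem_coe.2 (Finset.mem_product.2
    ⟨Finset.mem_range.2 (level_lt hq (u i 0)), Finset.mem_range.2 (level_lt hq (u i 1))⟩)]
  simp

theorem sum_sub_sq {ι : Type*} (T : Finset ι) (x : ι → ℝ) (m : ℝ) :
    ∑ c ∈ T, (x c - m) ^ 2 = ∑ c ∈ T, x c ^ 2 - 2 * m * ∑ c ∈ T, x c + T.card * m ^ 2 := by
  rw [← nsmul_eq_mul, ← Finset.sum_const, Finset.mul_sum, ← Finset.sum_sub_distrib,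
    ← Finset.sum_add_distrib]
  exact Finset.sum_congr rfl fun c _ => by ring

/-- The loss is, up to a constant, the total squared deviation of the row, column and cell
counts from any given levels. -/
theorem loss_eq_deviation {n q : ℕ} (hq : 0 < q) (u : Fin n → Fin 2 → ℝ) (m l : ℝ) :
    ∑ c ∈ Finset.range q, ((levelCount q (fun i => u i 0) c : ℝ) - m) ^ 2 +
      ∑ c ∈ Finset.range q, ((levelCount q (fun i => u i 1) c : ℝ) - m) ^ 2 +
      2 * ∑ c ∈ Finset.range q ×ˢ Finset.range q, ((cellCount q u c : ℝ) - l) ^ 2 =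
    2 * loss q u + (4 * n - 4 * m * n + 2 * q * m ^ 2 - 4 * l * n + 2 * q ^ 2 * l ^ 2) := by
  have h0 := sum_levelCount hq fun i => u i 0
  have h1 := sum_levelCount hq fun i => u i 1
  have h2 := sum_cellCount hq u
  have h3 := two_mul_loss_add hq u
  rify at h0 h1 h2 h3
  rw [sum_sub_sq, sum_sub_sq, sum_sub_sq, h0, h1, h2, Finset.card_product, Finset.card_range]
  push_cast
  linarith

/-- If the loss is at most the loss of a sample that fills the cells along the diagonals, then
the cell counts differ from the target value by `O(q)` in total. -/
theorem sum_abs_cellCount_sub_le {n q lam C : ℕ} (hCq : C < q) (hlam : 1 ≤ lam)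
    (hn : |(n : ℝ) - lam * q ^ 2| ≤ C * q) (u v : Fin n → Fin 2 → ℝ)
    (hv : ∀ i : Fin n, (level q (v i 0), level q (v i 1)) = diagonalCell q i)
    (huv : loss q u ≤ loss q v) :
    ∑ c ∈ Finset.range q ×ˢ Finset.range q, |(cellCount q u c : ℝ) - lam| ≤
      ((C + 1) ^ 2 + C) * q := by
  have hq : 0 < q := by omega
  have hq' : (0 : ℝ) < q := by exact_mod_cast hq
  -- A row or column count is within 1 of n / q, and n / q is within C of λq.
  have hnq : ∀ x : ℕ, n / q ≤ x → x ≤ n / q + 1 → ((x : ℝ) - lam * q) ^ 2 ≤ (C + 1) ^ 2 := by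
    intro x h1 h2
    have h3 : n < (x + 1) * q := by
      have := Nat.lt_div_mul_add (a := n) hq
      nlinarith
    have h4 : x * q ≤ n + q := by
      have := Nat.div_mul_le_self n q
      nlinarith
    rify at h3 h4
    rw [abs_le] at hn
    refine sq_le_sq' ?_ ?_ <;> refine le_of_mul_le_mul_right ?_ hq' <;> nlinarith
  have hr : ∀ t, (∀ c < q, n / q ≤ levelCount q (fun i => v i t) c ∧
      levelCount q (fun i => v i t) c ≤ n / q + 1) →
      ∑ c ∈ Finset.range q, ((levelCount q (fun i => v i t) c : ℝ) - lam * q) ^ 2 ≤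
        q * (C + 1) ^ 2 := by
    intro t ht
    refine (Finset.sum_le_card_nsmul _ _ ((C + 1 : ℝ) ^ 2) fun c hc => ?_).trans ?_
    · obtain ⟨h1, h2⟩ := ht c (Finset.mem_range.1 hc)
      exact hnq _ h1 h2
    · simp
  have hr0 := hr 0 fun c hc => by
    have := diagonalCell_fst_card (n := n) hc
    simp_rw [← hv] at this
    exact this
  have hr1 := hr 1 fun c hc => by
    have := diagonalCell_snd_card (n := n) hc
    simp_rw [← hv] at this
    exact this
  have hc : ∀ c ∈ Finset.range q ×ˢ Finset.range q, n / (q * q) ≤ cellCount q v c ∧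
      cellCount q v c ≤ n / (q * q) + 1 := by
    intro c hc
    simp only [Finset.mem_product, Finset.mem_range] at hc
    have := diagonalCell_card (n := n) hc.1 hc.2
    simp_rw [← hv] at this
    exact this
  have hsum : ∑ c ∈ Finset.range q ×ˢ Finset.range q, ((cellCount q v c : ℝ) - lam) =
      n - lam * q ^ 2 := by
    have := sum_cellCount hq v
    rify at this
    rw [Finset.sum_sub_distrib, this]
    simp; ring
  -- Since |n - λq²| ≤ Cq < q², λ is one of the two values the cell counts can take. All deviations
  -- are then 0 or a fixed sign times 1, so their squares add up to |n - λq²|.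
  have hc2 : ∑ c ∈ Finset.range q ×ˢ Finset.range q, ((cellCount q v c : ℝ) - lam) ^ 2 ≤
      C * q := by
    rw [abs_le] at hn
    have hCq' : (C : ℝ) + 1 ≤ q := by exact_mod_cast hCq
    rcases le_or_gt (lam * q ^ 2 : ℝ) n with h | h
    · have hdiv : n / (q * q) = lam := by
        refine Nat.div_eq_of_lt_le (by rify; linarith) ?_
        rify
        nlinarith
      rw [hdiv] at hc
      refine le_trans (le_of_eq ?_) (hsum.le.trans hn.2)
      refine Finset.sum_congr rfl fun c hcm => ?_
      have : cellCount q v c = lam ∨ cellCount q v c = lam + 1 := by have := hc c hcm; omega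
      rcases this with h | h <;> simp [h]
    · have hdiv : n / (q * q) + 1 = lam := by
        obtain ⟨l, rfl⟩ := Nat.exists_eq_add_of_le' hlam
        push_cast at hn h
        rw [Nat.div_eq_of_lt_le (k := l)]
        · rify
          nlinarith
        · rify
          linarith
      refine le_trans (le_of_eq ?_) (show -((n : ℝ) - lam * q ^ 2) ≤ C * q by linarith)
      rw [← hsum, ← Finset.sum_neg_distrib]
      refine Finset.sum_congr rfl fun c hcm => ?_
      have : cellCount q v c = lam ∨ cellCount q v c + 1 = lam := by have := hc c hcm; omega
      rcases this with h | h
      · simp [h]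
      · simp [← h]
  have hu := loss_eq_deviation hq u (lam * q) lam
  have hvv := loss_eq_deviation hq v (lam * q) lam
  have huv' : (loss q u : ℝ) ≤ loss q v := by exact_mod_cast huv
  -- Integrality is essential: Cauchy–Schwarz over q² cells would only give O(q^(3/2)).
  have habs : ∑ c ∈ Finset.range q ×ˢ Finset.range q, |(cellCount q u c : ℝ) - lam| ≤
      ∑ c ∈ Finset.range q ×ˢ Finset.range q, ((cellCount q u c : ℝ) - lam) ^ 2 := by
    refine Finset.sum_le_sum fun c _ => ?_
    have : |(cellCount q u c : ℤ) - lam| ≤ ((cellCount q u c : ℤ) - lam) ^ 2 := by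
      rw [Int.abs_eq_natAbs]
      exact Int.natAbs_le_self_sq _
    exact_mod_cast this
  -- The row and column terms of u are discarded; those of v cost 2q(C+1)² and its cells 2Cq.
  -- Halving gives the stated constant.
  have p0 : 0 ≤ ∑ c ∈ Finset.range q, ((levelCount q (fun i => u i 0) c : ℝ) - lam * q) ^ 2 :=
    Finset.sum_nonneg fun _ _ => sq_nonneg _
  have p1 : 0 ≤ ∑ c ∈ Finset.range q, ((levelCount q (fun i => u i 1) c : ℝ) - lam * q) ^ 2 :=
    Finset.sum_nonneg fun _ _ => sq_nonneg _
  linarith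

/-! ### Counting design points in intervals -/

theorem level_le_mul {q : ℕ} {w : ℝ} (hw : w ∈ Set.Icc (0 : ℝ) 1) : (level q w : ℝ) ≤ q * w := by
  have h1 : (level q w : ℝ) ≤ (⌊(q : ℝ) * w⌋₊ : ℝ) := by
    exact_mod_cast min_le_left _ _
  exact h1.trans (Nat.floor_le (mul_nonneg (Nat.cast_nonneg _) hw.1))

theorem mul_le_level_add_one {q : ℕ} {w : ℝ} (hq : 0 < q) (hw : w ∈ Set.Icc (0 : ℝ) 1) :
    q * w ≤ level q w + 1 := by
  have hq' : (0 : ℝ) < q := by exact_mod_cast hq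
  rcases min_choice ⌊(q : ℝ) * w⌋₊ (q - 1) with h | h
  · rw [level, h]
    exact (Nat.lt_floor_add_one _).le
  · rw [level, h, Nat.cast_pred hq]
    nlinarith [hw.2]

theorem abs_sub_level_div_le {q : ℕ} {w : ℝ} (hq : 0 < q) (hw : w ∈ Set.Icc (0 : ℝ) 1) :
    |w - level q w / q| ≤ 1 / q := by
  have hq' : (0 : ℝ) < q := by exact_mod_cast hq
  have h1 := level_le_mul (q := q) hw
  have h2 := mul_le_level_add_one hq hw
  have h3 : w - level q w / q = (q * w - level q w) / q := by field_simp
  rw [h3, abs_div, abs_of_pos hq']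
  gcongr
  rw [abs_le]
  constructor <;> linarith

theorem abs_sub_le_of_level_eq {q : ℕ} {w w' : ℝ} (hq : 0 < q) (hw : w ∈ Set.Icc (0 : ℝ) 1)
    (hw' : w' ∈ Set.Icc (0 : ℝ) 1) (h : level q w = level q w') : |w - w'| ≤ 1 / q := by
  have hq' : (0 : ℝ) < q := by exact_mod_cast hq
  have h1 := level_le_mul (q := q) hw
  have h2 := mul_le_level_add_one hq hw
  have h1' := level_le_mul (q := q) hw'
  have h2' := mul_le_level_add_one hq hw'
  rw [h] at h1 h2
  have h3 : w - w' = (q * w - q * w') / q := by field_simp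
  rw [h3, abs_div, abs_of_pos hq']
  gcongr
  rw [abs_le]
  constructor <;> linarith

theorem card_filter_le_sum_levelCount {n q : ℕ} {u : Fin n → ℝ} {s t : ℝ} {T : Finset ℕ}
    (hT : ∀ i, u i ∈ Set.Icc s t → level q (u i) ∈ T) :
    (Finset.univ.filter fun i => s ≤ u i ∧ u i ≤ t).card ≤ ∑ c ∈ T, levelCount q u c := by
  rw [Finset.card_eq_sum_card_fiberwise (f := fun i => level q (u i)) (t := T)
    (by intro i hi; exact hT i (by simpa using hi))]
  refine Finset.sum_le_sum fun c _ => Finset.card_le_card ?_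
  intro i hi
  simp only [Finset.mem_filter, Finset.mem_univ, true_and] at hi ⊢
  exact hi.2

theorem sum_levelCount_le_card_filter {n q : ℕ} {u : Fin n → ℝ} {s t : ℝ} {T : Finset ℕ}
    (hT : ∀ i, level q (u i) ∈ T → u i ∈ Set.Icc s t) :
    ∑ c ∈ T, levelCount q u c ≤ (Finset.univ.filter fun i => s ≤ u i ∧ u i ≤ t).card := by
  unfold levelCount
  rw [← Finset.card_biUnion]
  · refine Finset.card_le_card ?_
    intro i hi
    simp only [Finset.mem_biUnion, Finset.mem_filter, Finset.mem_univ, true_and] at hi ⊢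
    obtain ⟨c, hc, rfl⟩ := hi
    exact hT i hc
  · intro c _ c' _ h
    rw [Function.onFun, Finset.disjoint_left]
    intro i hi hi'
    simp only [Finset.mem_filter, Finset.mem_univ, true_and] at hi hi'
    exact h (hi ▸ hi')

theorem abs_sum_levelCount_sub_le {n q : ℕ} {u : Fin n → ℝ} {m D : ℝ}
    (hD : ∑ c ∈ Finset.range q, |(levelCount q u c : ℝ) - m| ≤ D) {T : Finset ℕ}
    (hT : T ⊆ Finset.range q) :
    |(∑ c ∈ T, levelCount q u c : ℕ) - T.card * m| ≤ D := by
  refine le_trans ?_ ((Finset.sum_le_sum_of_subset_of_nonneg hT fun _ _ _ => abs_nonneg _).trans hD)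
  refine le_trans (le_of_eq ?_) (Finset.abs_sum_le_sum_abs _ _)
  rw [Finset.sum_sub_distrib]
  simp

/-- At most q(t - s) + 2 levels meet [s, t]; each holds λq points, up to a total error Dq. -/
theorem card_Icc_filter_le {n q : ℕ} (hq : 0 < q) {u : Fin n → ℝ}
    (hu : ∀ i, u i ∈ Set.Icc (0 : ℝ) 1) {lam D : ℝ} (hlam : 0 ≤ lam) (hD0 : 0 ≤ D)
    (hD : ∑ c ∈ Finset.range q, |(levelCount q u c : ℝ) - lam * q| ≤ D * q) {s t : ℝ}
    (hst : s ≤ t) :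
    ((Finset.univ.filter fun i => s ≤ u i ∧ u i ≤ t).card : ℝ) ≤
      (2 * lam + D) * (q * (q * (t - s) + 1)) := by
  have hq' : (0 : ℝ) < q := by exact_mod_cast hq
  set T := (Finset.range q).filter fun c : ℕ => q * s - 1 ≤ (c : ℝ) ∧ (c : ℝ) ≤ q * t with hTdef
  have hcard : (T.card : ℝ) ≤ q * (t - s) + 2 := by
    rcases T.eq_empty_or_nonempty with h | ⟨c, hc⟩
    · rw [h]; simp; nlinarith
    · have hc' := (Finset.mem_filter.1 hc).2
      have ht0 : 0 ≤ q * t := (Nat.cast_nonneg c).trans hc'.2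
      have hsub : T ⊆ Finset.Icc ⌈q * s - 1⌉₊ ⌊q * t⌋₊ := by
        intro x hx
        have hx' := (Finset.mem_filter.1 hx).2
        exact Finset.mem_Icc.2 ⟨Nat.ceil_le.2 hx'.1, Nat.le_floor hx'.2⟩
      have h1 : (T.card : ℝ) ≤ (⌊q * t⌋₊ + 1 - ⌈q * s - 1⌉₊ : ℕ) := by
        exact_mod_cast (Finset.card_le_card hsub).trans (by simp)
      have hle : ⌈q * s - 1⌉₊ ≤ ⌊q * t⌋₊ + 1 := by
        have := Finset.mem_Icc.1 (hsub hc); omega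
      rw [Nat.cast_sub hle] at h1
      have h2 := Nat.floor_le ht0
      have h3 := Nat.le_ceil (q * s - 1)
      push_cast at h1
      linarith
  have h1 : ((Finset.univ.filter fun i => s ≤ u i ∧ u i ≤ t).card : ℝ) ≤
      (∑ c ∈ T, levelCount q u c : ℕ) := by
    exact_mod_cast card_filter_le_sum_levelCount fun i hi => by
      have h1 := level_le_mul (q := q) (hu i)
      have h2 := mul_le_level_add_one hq (hu i)
      refine Finset.mem_filter.2 ⟨Finset.mem_range.2 (level_lt hq _), ?_, ?_⟩
      · nlinarith [hi.1]
      · nlinarith [hi.2]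
  have h2 := abs_le.1 (abs_sum_levelCount_sub_le hD (Finset.filter_subset _ _ : T ⊆ _))
  have h3 : (T.card : ℝ) * (lam * q) ≤ (q * (t - s) + 2) * (lam * q) := by gcongr
  have h4 : 0 ≤ lam * q * (q * (t - s)) := by
    have : 0 ≤ t - s := by linarith
    positivity
  have h5 : 0 ≤ D * q * (q * (t - s)) := by
    have : 0 ≤ t - s := by linarith
    positivity
  nlinarith [h2.2]

/-- At least q(t - s) - 2 levels lie entirely inside [s, t]. -/
theorem le_card_Icc_filter {n q : ℕ} (hq : 0 < q) {u : Fin n → ℝ}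
    (hu : ∀ i, u i ∈ Set.Icc (0 : ℝ) 1) {lam D : ℝ} (hlam : 0 ≤ lam)
    (hD : ∑ c ∈ Finset.range q, |(levelCount q u c : ℝ) - lam * q| ≤ D * q) {s t : ℝ}
    (hs : 0 ≤ s) (ht : t ≤ 1) :
    (q * (t - s) - 2) * (lam * q) - D * q ≤
      ((Finset.univ.filter fun i => s ≤ u i ∧ u i ≤ t).card : ℝ) := by
  have hq' : (0 : ℝ) < q := by exact_mod_cast hq
  set T := (Finset.range q).filter fun c : ℕ => q * s ≤ (c : ℝ) ∧ (c : ℝ) + 1 ≤ q * t with hTdef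
  have hcard : q * (t - s) - 2 ≤ (T.card : ℝ) := by
    have hsub : Finset.Ico ⌈q * s⌉₊ ⌊q * t⌋₊ ⊆ T := by
      intro x hx
      have hx' := Finset.mem_Ico.1 hx
      have h1 : q * s ≤ (x : ℝ) := Nat.ceil_le.1 hx'.1
      have h2 : (x : ℝ) + 1 ≤ q * t := by
        have := (Nat.le_floor_iff' (by omega)).1 (Nat.succ_le_of_lt hx'.2)
        exact_mod_cast this
      refine Finset.mem_filter.2 ⟨Finset.mem_range.2 ?_, h1, h2⟩
      have : (x : ℝ) < q := by nlinarith
      exact_mod_cast this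
    have h1 : ((⌊q * t⌋₊ - ⌈q * s⌉₊ : ℕ) : ℝ) ≤ T.card := by
      exact_mod_cast (Nat.card_Ico _ _).symm.le.trans (Finset.card_le_card hsub)
    have h2 : (⌊q * t⌋₊ : ℝ) - ⌈q * s⌉₊ ≤ ((⌊q * t⌋₊ - ⌈q * s⌉₊ : ℕ) : ℝ) := by
      rw [sub_le_iff_le_add]
      have : ⌊q * t⌋₊ ≤ ⌊q * t⌋₊ - ⌈q * s⌉₊ + ⌈q * s⌉₊ := by omega
      exact_mod_cast this
    have h3 := Nat.lt_floor_add_one (q * t)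
    have h4 := Nat.ceil_lt_add_one (mul_nonneg hq'.le hs)
    linarith
  have h1 : ((∑ c ∈ T, levelCount q u c : ℕ) : ℝ) ≤
      ((Finset.univ.filter fun i => s ≤ u i ∧ u i ≤ t).card : ℝ) := by
    exact_mod_cast sum_levelCount_le_card_filter fun i hi => by
      have h1 := level_le_mul (q := q) (hu i)
      have h2 := mul_le_level_add_one hq (hu i)
      have h3 := (Finset.mem_filter.1 hi).2
      constructor
      · exact le_of_mul_le_mul_left (h3.1.trans h1) hq'
      · exact le_of_mul_le_mul_left (h2.trans h3.2) hq'
  have h2 := abs_le.1 (abs_sum_levelCount_sub_le hD (Finset.filter_subset _ _ : T ⊆ _))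
  have h3 : (q * (t - s) - 2) * (lam * q) ≤ (T.card : ℝ) * (lam * q) := by gcongr
  linarith [h2.1]

/-! ### Window functions -/

/-- `G` is supported in `[-1, 1]`, bounded by `B`, and `B`-Lipschitz on `[-1, 1]`. -/
structure IsWindow (B : ℝ) (G : ℝ → ℝ) : Prop where
  nonneg : 0 ≤ B
  abs_le : ∀ x, |G x| ≤ B
  eq_zero : ∀ x, 1 < |x| → G x = 0
  abs_sub_le : ∀ x y, |x| ≤ 1 → |y| ≤ 1 → |G x - G y| ≤ B * |x - y|

theorem IsWindow.mono {B B' : ℝ} {G : ℝ → ℝ} (hG : IsWindow B G) (h : B ≤ B') :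
    IsWindow B' G where
  nonneg := hG.nonneg.trans h
  abs_le x := (hG.abs_le x).trans h
  eq_zero := hG.eq_zero
  abs_sub_le x y hx hy := (hG.abs_sub_le x y hx hy).trans (by gcongr)

theorem IsWindow.mul_id {B : ℝ} {G : ℝ → ℝ} (hG : IsWindow B G) :
    IsWindow (2 * B) fun x => G x * x where
  nonneg := by linarith [hG.nonneg]
  abs_le x := by
    rcases le_or_gt |x| 1 with h | h
    · rw [abs_mul]
      have := hG.nonneg
      have := mul_le_mul (hG.abs_le x) h (abs_nonneg _) hG.nonneg
      linarith
    · simp [hG.eq_zero x h, hG.nonneg]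
  eq_zero x h := by simp [hG.eq_zero x h]
  abs_sub_le x y hx hy := by
    have h1 : G x * x - G y * y = (G x - G y) * x + G y * (x - y) := by ring
    rw [h1]
    refine (abs_add_le _ _).trans ?_
    rw [abs_mul, abs_mul]
    have h2 := mul_le_mul (hG.abs_sub_le x y hx hy) hx (abs_nonneg _)
      (mul_nonneg hG.nonneg (abs_nonneg _))
    have h3 := mul_le_mul_of_nonneg_right (hG.abs_le y) (abs_nonneg (x - y))
    linarith

theorem isWindow_of_lipschitzOnWith {K : ℝ → ℝ} (hKsupp : ∀ u, 1 < |u| → K u = 0) {M : ℝ≥0}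
    (hKlip : LipschitzOnWith M K (Set.Icc (-1) 1)) : IsWindow (|K 0| + M) K where
  nonneg := by positivity
  abs_le x := by
    rcases le_or_gt |x| 1 with h | h
    · have h1 := hKlip.dist_le_mul x (Set.mem_Icc.2 (_root_.abs_le.1 h)) 0 (by simp)
      rw [Real.dist_eq, Real.dist_eq, sub_zero] at h1
      have h2 := abs_sub_abs_le_abs_sub (K x) (K 0)
      have h3 : (M : ℝ) * |x| ≤ M * 1 := by gcongr
      linarith
    · rw [hKsupp x h, abs_zero]; positivity
  eq_zero := hKsupp
  abs_sub_le x y hx hy := by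
    have h1 := hKlip.dist_le_mul x (Set.mem_Icc.2 (_root_.abs_le.1 hx)) y (Set.mem_Icc.2 (_root_.abs_le.1 hy))
    rw [Real.dist_eq, Real.dist_eq] at h1
    refine h1.trans ?_
    gcongr
    linarith [abs_nonneg (K 0)]

section Window

variable {n q : ℕ} {u : Fin n → ℝ} {A B h : ℝ} {G : ℝ → ℝ}

theorem sum_ite_eq_card_mul {ι : Type*} [Fintype ι] (p : ι → Prop) [DecidablePred p] (x : ℝ) :
    ∑ i, (if p i then x else 0) = (Finset.univ.filter p).card * x := by
  rw [← Finset.sum_filter, Finset.sum_const, nsmul_eq_mul]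

/-- Only points within h of z contribute. There are at most A q (2qh + 1) ≤ 3A q²h ≤ 6A nh of them,
by qh ≥ 1 and q² ≤ 2n. -/
theorem IsWindow.sum_abs_le (hG : IsWindow B G) (hA : 0 ≤ A)
    (hcount : ∀ s t, s ≤ t →
      ((Finset.univ.filter fun i => s ≤ u i ∧ u i ≤ t).card : ℝ) ≤ A * (q * (q * (t - s) + 1)))
    (hq : 0 < q) (hqn : (q : ℝ) ^ 2 ≤ 2 * n) (hh : 0 < h) (hqh : 1 ≤ q * h) (z : ℝ) :
    1 / (n * h) * ∑ j, |G ((u j - z) / h)| ≤ 6 * B * A := by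
  have hq' : (0 : ℝ) < q := by exact_mod_cast hq
  have hn' : (0 : ℝ) < n := by nlinarith
  have hB := hG.nonneg
  have h1 : ∀ j, |G ((u j - z) / h)| ≤ if z - h ≤ u j ∧ u j ≤ z + h then B else 0 := by
    intro j
    split_ifs with hj
    · exact hG.abs_le _
    · rw [hG.eq_zero, abs_zero]
      rw [abs_div, abs_of_pos hh, one_lt_div hh]
      by_contra! hc
      rw [_root_.abs_le] at hc
      exact hj ⟨by linarith, by linarith⟩
  have h2 := (Finset.sum_le_sum fun j _ => h1 j).trans_eq
    (sum_ite_eq_card_mul (fun j => z - h ≤ u j ∧ u j ≤ z + h) B)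
  have h3 := mul_le_mul_of_nonneg_right (hcount (z - h) (z + h) (by linarith)) hB
  rw [one_div, inv_mul_le_iff₀ (by positivity)]
  have h4 : A * (q * (q * (z + h - (z - h)) + 1)) ≤ A * (3 * (q ^ 2 * h)) := by
    refine mul_le_mul_of_nonneg_left ?_ hA
    nlinarith
  have h5 : A * (3 * (q ^ 2 * h)) ≤ A * (3 * ((2 * n) * h)) := by gcongr
  have h6 := mul_le_mul_of_nonneg_right (h4.trans h5) hB
  linarith

/-- Inside the window the Lipschitz bound applies. G may jump at ±1, which costs B, but only if x
lies within δ of ±h. -/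
theorem IsWindow.abs_sub_le_ite (hG : IsWindow B G) (hh : 0 < h) {δ x x' : ℝ}
    (hxx' : |x - x'| ≤ δ) :
    |G (x / h) - G (x' / h)| ≤ (if |x| ≤ h then B * (δ / h) else 0) +
      ((if -h - δ ≤ x ∧ x ≤ -h + δ then B else 0) + if h - δ ≤ x ∧ x ≤ h + δ then B else 0) := by
  have hB := hG.nonneg
  have hδ : 0 ≤ δ := (abs_nonneg _).trans hxx'
  have hi1 : 0 ≤ if |x| ≤ h then B * (δ / h) else 0 := by split_ifs <;> positivity
  have hi2 : 0 ≤ if -h - δ ≤ x ∧ x ≤ -h + δ then B else 0 := by split_ifs <;> positivity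
  have hi3 : 0 ≤ if h - δ ≤ x ∧ x ≤ h + δ then B else 0 := by split_ifs <;> positivity
  have habs : ∀ y : ℝ, |y / h| = |y| / h := fun y => by rw [abs_div, abs_of_pos hh]
  have hedge : h - δ ≤ |x| → |x| ≤ h + δ → B ≤
      ((if -h - δ ≤ x ∧ x ≤ -h + δ then B else 0) + if h - δ ≤ x ∧ x ≤ h + δ then B else 0) := by
    intro h1 h2
    rcases abs_cases x with ⟨h3, h4⟩ | ⟨h3, h4⟩
    · rw [if_pos (show h - δ ≤ x ∧ x ≤ h + δ from ⟨by linarith, by linarith⟩)]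
      linarith
    · rw [if_pos (show -h - δ ≤ x ∧ x ≤ -h + δ from ⟨by linarith, by linarith⟩)]
      linarith
  have htri := (abs_sub_abs_le_abs_sub x x').trans hxx'
  have htri' := (abs_sub_abs_le_abs_sub x' x).trans ((abs_sub_comm _ _).trans_le hxx')
  rcases le_or_gt |x| h with h1 | h1 <;> rcases le_or_gt |x'| h with h2 | h2
  · rw [if_pos h1]
    have h3 := hG.abs_sub_le (x / h) (x' / h) (by rwa [habs, div_le_one hh])
      (by rwa [habs, div_le_one hh])
    rw [← sub_div, habs] at h3
    have h4 : B * (|x - x'| / h) ≤ B * (δ / h) := by gcongr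
    linarith
  · rw [hG.eq_zero (x' / h) (by rwa [habs, one_lt_div hh]), sub_zero]
    linarith [hedge (by linarith) (by linarith), hG.abs_le (x / h)]
  · rw [hG.eq_zero (x / h) (by rwa [habs, one_lt_div hh]), zero_sub, abs_neg]
    linarith [hedge (by linarith) (by linarith), hG.abs_le (x' / h)]
  · rw [hG.eq_zero (x / h) (by rwa [habs, one_lt_div hh]),
      hG.eq_zero (x' / h) (by rwa [habs, one_lt_div hh]), sub_zero, abs_zero]
    linarith

/-- About q²h interior points change by B/(qh) each, and two edge strips of width 2/q hold at most
3Aq points each, which change by at most B. All three contributions are at most 3ABq, and q/n ≤ 2/q.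
-/
theorem IsWindow.sum_abs_sub_le (hG : IsWindow B G) (hA : 0 ≤ A)
    (hcount : ∀ s t, s ≤ t →
      ((Finset.univ.filter fun i => s ≤ u i ∧ u i ≤ t).card : ℝ) ≤ A * (q * (q * (t - s) + 1)))
    (hq : 0 < q) (hqn : (q : ℝ) ^ 2 ≤ 2 * n) (hh : 0 < h) (hqh : 1 ≤ q * h) (z : ℝ)
    (x : Fin n → ℝ) (hx : ∀ j, |u j - z - x j| ≤ 1 / q) :
    1 / (n * h) * ∑ j, |G ((u j - z) / h) - G (x j / h)| ≤ 18 * B * A * (1 / (q * h)) := by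
  have hq' : (0 : ℝ) < q := by exact_mod_cast hq
  have hn' : (0 : ℝ) < n := by nlinarith
  have hB := hG.nonneg
  have h1 := Finset.sum_le_sum fun j (_ : j ∈ Finset.univ) => hG.abs_sub_le_ite hh (hx j)
  rw [Finset.sum_add_distrib, Finset.sum_add_distrib, sum_ite_eq_card_mul, sum_ite_eq_card_mul,
    sum_ite_eq_card_mul] at h1
  have hrw : ∀ a b : ℝ, (Finset.univ.filter fun j => a ≤ u j - z ∧ u j - z ≤ b) =
      Finset.univ.filter fun j => z + a ≤ u j ∧ u j ≤ z + b := by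
    intro a b
    ext j
    simp only [Finset.mem_filter, Finset.mem_univ, true_and]
    constructor <;> rintro ⟨h1, h2⟩ <;> constructor <;> linarith
  simp_rw [_root_.abs_le, hrw] at h1
  have hd : (0 : ℝ) < 1 / q := by positivity
  have c1 := hcount (z + -h) (z + h) (by linarith)
  have c2 := hcount (z + (-h - 1 / q)) (z + (-h + 1 / q)) (by linarith)
  have c3 := hcount (z + (h - 1 / q)) (z + (h + 1 / q)) (by linarith)
  have e1 : A * (q * (q * (z + h - (z + -h)) + 1)) ≤ A * (3 * (q ^ 2 * h)) := by
    refine mul_le_mul_of_nonneg_left ?_ hA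
    nlinarith
  have e2 : A * (q * (q * (z + (-h + 1 / q) - (z + (-h - 1 / q))) + 1)) = A * (3 * q) := by
    field_simp; ring
  have e3 : A * (q * (q * (z + (h + 1 / q) - (z + (h - 1 / q))) + 1)) = A * (3 * q) := by
    field_simp; ring
  have f1 := mul_le_mul_of_nonneg_right (c1.trans e1) (show 0 ≤ B * (1 / q / h) by positivity)
  have f2 := mul_le_mul_of_nonneg_right (c2.trans e2.le) hB
  have f3 := mul_le_mul_of_nonneg_right (c3.trans e3.le) hB
  have g1 : A * (3 * (q ^ 2 * h)) * (B * (1 / q / h)) = 3 * A * B * q := by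
    field_simp
  have g2 : ∑ j, |G ((u j - z) / h) - G (x j / h)| ≤ 9 * A * B * q := by linarith
  rw [one_div, inv_mul_le_iff₀ (by positivity)]
  have g3 : n * h * (18 * B * A * (1 / (q * h))) = 9 * A * B * ((2 * n) / q) := by
    field_simp; ring
  rw [g3]
  refine g2.trans ?_
  gcongr
  rw [le_div_iff₀ hq']
  linarith

end Window

/-! ### Local linear smoothers on nearly uniform designs -/

theorem IsWindow.mul_pow {B : ℝ} {G : ℝ → ℝ} (hG : IsWindow B G) (r : ℕ) :
    IsWindow (2 ^ r * B) fun x => G x * x ^ r := by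
  induction r with
  | zero => simpa using hG
  | succ r ih =>
    have h1 := ih.mul_id
    simp_rw [pow_succ, ← mul_assoc]
    convert h1 using 1
    ring

/-- The moment `V_r(z) / h ^ r`, normalized for the bandwidth. -/
def scaledMoment {n : ℕ} (K : ℝ → ℝ) (h : ℝ) (u : Fin n → ℝ) (r : ℕ) (z : ℝ) : ℝ :=
  1 / (n * h) * ∑ j, K ((u j - z) / h) * ((u j - z) / h) ^ r

/-- The determinant `(V₀ V₂ - V₁²) / h²`, normalized for the bandwidth. -/
def scaledDet {n : ℕ} (K : ℝ → ℝ) (h : ℝ) (u : Fin n → ℝ) (z : ℝ) : ℝ :=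
  scaledMoment K h u 0 z * scaledMoment K h u 2 z - scaledMoment K h u 1 z ^ 2

/-- The weight of an observation at `x` in the local linear fit at `z`. -/
def localWeight {n : ℕ} (K : ℝ → ℝ) (h : ℝ) (u : Fin n → ℝ) (z x : ℝ) : ℝ :=
  1 / (n * h) * (K ((x - z) / h) * ((x - z) / h) ^ 0 * (scaledMoment K h u 2 z / scaledDet K h u z) -
    K ((x - z) / h) * ((x - z) / h) ^ 1 * (scaledMoment K h u 1 z / scaledDet K h u z))

section Smoother

variable {n q : ℕ} {u : Fin n → ℝ} {K : ℝ → ℝ} {h : ℝ}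

theorem moment_eq (hh : h ≠ 0) (r : ℕ) (z : ℝ) :
    moment K h u r z = h ^ r * scaledMoment K h u r z := by
  unfold moment scaledMoment
  rw [one_div_mul_eq_div, one_div_mul_eq_div, Finset.sum_div, Finset.sum_div, Finset.mul_sum]
  refine Finset.sum_congr rfl fun j _ => ?_
  rw [div_pow]
  by_cases hn : (n : ℝ) = 0
  · simp [hn]
  field_simp

theorem localDet_eq (hh : h ≠ 0) (z : ℝ) : localDet K h u z = h ^ 2 * scaledDet K h u z := by
  unfold localDet scaledDet
  rw [moment_eq hh, moment_eq hh, moment_eq hh]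
  ring

theorem smoother_apply (hh : h ≠ 0) (i j : Fin n) :
    smoother K h u i j = localWeight K h u (u i) (u j) := by
  unfold smoother localWeight
  rw [Matrix.of_apply, localDet_eq hh, moment_eq hh, moment_eq hh]
  have h1 : h ^ 2 * scaledMoment K h u 2 (u i) - (u j - u i) * (h ^ 1 * scaledMoment K h u 1 (u i)) =
      h ^ 2 * (scaledMoment K h u 2 (u i) - (u j - u i) / h * scaledMoment K h u 1 (u i)) := by
    field_simp
  rw [h1, mul_div_assoc, mul_div_mul_left _ _ (pow_ne_zero 2 hh)]
  ring

theorem sum_localWeight {z : ℝ} (hd : scaledDet K h u z ≠ 0) :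
    ∑ j, localWeight K h u z (u j) = 1 := by
  unfold localWeight
  rw [← Finset.mul_sum, Finset.sum_sub_distrib, ← Finset.sum_mul, ← Finset.sum_mul, mul_sub,
    ← mul_assoc, ← mul_assoc]
  change scaledMoment K h u 0 z * _ - scaledMoment K h u 1 z * _ = 1
  rw [← mul_div_assoc, ← mul_div_assoc, ← sub_div, ← sq]
  exact div_self hd

/-- Lagrange's identity. For K ≥ 0 the terms on the right are nonnegative, so a lower bound needs
only a part of the double sum. -/
theorem two_mul_scaledDet (z : ℝ) :
    2 * scaledDet K h u z = (1 / (n * h)) ^ 2 * ∑ i, ∑ j, K ((u i - z) / h) * K ((u j - z) / h) *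
      ((u i - z) / h - (u j - z) / h) ^ 2 := by
  unfold scaledDet scaledMoment
  set t := fun i => (u i - z) / h
  have h1 : ∑ i, ∑ j, K (t i) * K (t j) * (t i - t j) ^ 2 =
      2 * ((∑ j, K (t j) * t j ^ 0) * (∑ j, K (t j) * t j ^ 2) - (∑ j, K (t j) * t j ^ 1) ^ 2) := by
    have h2 : ∀ i j, K (t i) * K (t j) * (t i - t j) ^ 2 =
        (K (t i) * t i ^ 2) * (K (t j) * t j ^ 0) + (K (t i) * t i ^ 0) * (K (t j) * t j ^ 2) -
          2 * ((K (t i) * t i ^ 1) * (K (t j) * t j ^ 1)) := by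
      intro i j; ring
    simp_rw [h2, Finset.sum_sub_distrib, Finset.sum_add_distrib, ← Finset.mul_sum,
      ← Finset.sum_mul]
    ring
  change _ = _ * ∑ i, ∑ j, K (t i) * K (t j) * (t i - t j) ^ 2
  rw [h1]
  ring

/-- Only the pairs in I × J are kept: two groups of order nh points in the window, at scaled
distance γ, prevent the local fit from degenerating. -/
theorem le_scaledDet (hh : 0 < h) (hn : 0 < n) {z κ γ m : ℝ} (hK0 : ∀ x, 0 ≤ K x) (hκ : 0 ≤ κ)
    (hγ : 0 ≤ γ) (hm : 0 ≤ m) {I J : Finset (Fin n)}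
    (hI : ∀ i ∈ I, κ ≤ K ((u i - z) / h)) (hJ : ∀ j ∈ J, κ ≤ K ((u j - z) / h))
    (hIJ : ∀ i ∈ I, ∀ j ∈ J, γ ≤ |(u i - z) / h - (u j - z) / h|)
    (hIm : m * (n * h) ≤ I.card) (hJm : m * (n * h) ≤ J.card) :
    (m * κ * γ) ^ 2 / 2 ≤ scaledDet K h u z := by
  have hn' : (0 : ℝ) < n := by exact_mod_cast hn
  have h1 : (I.card : ℝ) * (J.card * (κ * κ * γ ^ 2)) ≤
      ∑ i, ∑ j, K ((u i - z) / h) * K ((u j - z) / h) * ((u i - z) / h - (u j - z) / h) ^ 2 := by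
    have hpos : ∀ i j, 0 ≤ K ((u i - z) / h) * K ((u j - z) / h) *
        ((u i - z) / h - (u j - z) / h) ^ 2 := fun i j =>
      mul_nonneg (mul_nonneg (hK0 _) (hK0 _)) (sq_nonneg _)
    refine le_trans ?_ (Finset.sum_le_sum_of_subset_of_nonneg (Finset.subset_univ I)
      fun i _ _ => Finset.sum_nonneg fun j _ => hpos i j)
    rw [← nsmul_eq_mul, ← nsmul_eq_mul]
    refine Finset.card_nsmul_le_sum _ _ _ fun i hi => ?_
    refine le_trans ?_ (Finset.sum_le_sum_of_subset_of_nonneg (Finset.subset_univ J)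
      fun j _ _ => hpos i j)
    refine Finset.card_nsmul_le_sum _ _ _ fun j hj => ?_
    have h2 := hI i hi
    have h3 := hJ j hj
    have h5 := mul_le_mul h2 h3 hκ (hK0 _)
    have h4 : γ ^ 2 ≤ ((u i - z) / h - (u j - z) / h) ^ 2 := by
      rw [← sq_abs (_ - _)]
      exact pow_le_pow_left₀ hγ (hIJ i hi j hj) 2
    exact mul_le_mul h5 h4 (sq_nonneg _) (mul_nonneg (hK0 _) (hK0 _))
  have h2 : (m * (n * h)) * ((m * (n * h)) * (κ * κ * γ ^ 2)) ≤
      (I.card : ℝ) * (J.card * (κ * κ * γ ^ 2)) := by gcongr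
  have h3 := two_mul_scaledDet (K := K) (h := h) (u := u) z
  have h4 : (1 / (n * h)) ^ 2 * ((m * (n * h)) * ((m * (n * h)) * (κ * κ * γ ^ 2))) ≤
      2 * scaledDet K h u z := by
    rw [h3]; gcongr; exact h2.trans h1
  have h5 : (1 / (n * h)) ^ 2 * ((m * (n * h)) * ((m * (n * h)) * (κ * κ * γ ^ 2))) =
      (m * κ * γ) ^ 2 := by field_simp
  linarith

theorem abs_mul_sub_mul_le {a b p r P : ℝ} (hp : |p| ≤ P) (hr : |r| ≤ P) :
    |a * p - b * r| ≤ |a| * P + |b| * P := by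
  refine (abs_sub _ _).trans ?_
  rw [abs_mul, abs_mul]
  gcongr

/-- Local linear weights are stable as soon as the normalized window functions are summable and
have small total variation at the scale `1 / q`. -/
theorem localWeight_bounds {B V Q c ε : ℝ} (hB : ∀ r ≤ 2, ∀ x, |K x * x ^ r| ≤ B)
    (hh : 0 < h) (hc : 0 < c) (hV0 : 0 ≤ V)
    (hd : ∀ z ∈ Set.Icc (0 : ℝ) 1, c ≤ scaledDet K h u z)
    (hV : ∀ r ≤ 2, ∀ z, 1 / (n * h) * ∑ j, |K ((u j - z) / h) * ((u j - z) / h) ^ r| ≤ V)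
    (hQ : ∀ r ≤ 2, ∀ (z : ℝ) (x : Fin n → ℝ), (∀ j, |u j - z - x j| ≤ ε) →
      1 / (n * h) * ∑ j, |K ((u j - z) / h) * ((u j - z) / h) ^ r - K (x j / h) * (x j / h) ^ r| ≤ Q)
    {z : ℝ} (hz : z ∈ Set.Icc (0 : ℝ) 1) :
    (∀ x, |localWeight K h u z x| ≤ 2 * B * (V / c) / (n * h)) ∧
    ∑ j, |localWeight K h u z (u j)| ≤ 2 * V * (V / c) ∧
    (∀ x : Fin n → ℝ, (∀ j, |u j - x j| ≤ ε) →
      ∑ j, |localWeight K h u z (u j) - localWeight K h u z (x j)| ≤ 2 * (V / c) * Q) ∧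
    (∀ z' ∈ Set.Icc (0 : ℝ) 1, |z - z'| ≤ ε →
      ∑ j, |localWeight K h u z (u j) - localWeight K h u z' (u j)| ≤
        2 * (V / c + V * (1 / c + 4 * V ^ 2 / c ^ 2)) * Q) := by
  have hnh : 0 ≤ 1 / (n * h) := by positivity
  have hvV : ∀ r ≤ 2, ∀ z, |scaledMoment K h u r z| ≤ V := by
    intro r hr z
    refine le_trans ?_ (hV r hr z)
    unfold scaledMoment
    rw [abs_mul, abs_of_nonneg hnh]
    gcongr
    exact Finset.abs_sum_le_sum_abs _ _
  have hvQ : ∀ r ≤ 2, ∀ z z', |z - z'| ≤ ε →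
      |scaledMoment K h u r z - scaledMoment K h u r z'| ≤ Q := by
    intro r hr z z' hzz'
    -- Moving the centre from z to z' displaces every argument by z - z', so the bound for displaced
    -- points covers it.
    refine le_trans ?_ (hQ r hr z (fun j => u j - z') fun j => ?_)
    · unfold scaledMoment
      rw [← mul_sub, ← Finset.sum_sub_distrib, abs_mul, abs_of_nonneg hnh]
      gcongr
      exact Finset.abs_sum_le_sum_abs _ _
    · rw [show u j - z - (u j - z') = -(z - z') by ring, abs_neg]
      exact hzz'
  have hpV : ∀ r ≤ 2, |scaledMoment K h u r z / scaledDet K h u z| ≤ V / c := by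
    intro r hr
    rw [abs_div, abs_of_pos (hc.trans_le (hd z hz))]
    exact div_le_div₀ hV0 (hvV r hr z) hc (hd z hz)
  have hB0 : 0 ≤ B := (abs_nonneg _).trans (hB 0 (by norm_num) 0)
  have hVc : 0 ≤ V / c := by positivity
  refine ⟨fun x => ?_, ?_, fun x hx => ?_, fun z' hz' hzz' => ?_⟩
  · unfold localWeight
    rw [abs_mul, abs_of_nonneg hnh, mul_comm, mul_one_div]
    gcongr
    refine (abs_mul_sub_mul_le (hpV 2 le_rfl) (hpV 1 (by norm_num))).trans ?_
    have h1 := mul_le_mul_of_nonneg_right (hB 0 (by norm_num) ((x - z) / h)) hVc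
    have h2 := mul_le_mul_of_nonneg_right (hB 1 (by norm_num) ((x - z) / h)) hVc
    linarith
  · have h1 : ∀ j, |localWeight K h u z (u j)| ≤
        1 / (n * h) * (|K ((u j - z) / h) * ((u j - z) / h) ^ 0| * (V / c) +
          |K ((u j - z) / h) * ((u j - z) / h) ^ 1| * (V / c)) := by
      intro j
      unfold localWeight
      rw [abs_mul, abs_of_nonneg hnh]
      gcongr
      exact abs_mul_sub_mul_le (hpV 2 le_rfl) (hpV 1 (by norm_num))
    refine (Finset.sum_le_sum fun j _ => h1 j).trans ?_
    rw [← Finset.mul_sum, Finset.sum_add_distrib, ← Finset.sum_mul, ← Finset.sum_mul, mul_add,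
      ← mul_assoc, ← mul_assoc]
    have h2 := mul_le_mul_of_nonneg_right (hV 0 (by norm_num) z) hVc
    have h3 := mul_le_mul_of_nonneg_right (hV 1 (by norm_num) z) hVc
    linarith
  · have h1 : ∀ j, |localWeight K h u z (u j) - localWeight K h u z (x j)| ≤
        1 / (n * h) * (|K ((u j - z) / h) * ((u j - z) / h) ^ 0 -
            K ((x j - z) / h) * ((x j - z) / h) ^ 0| * (V / c) +
          |K ((u j - z) / h) * ((u j - z) / h) ^ 1 -
            K ((x j - z) / h) * ((x j - z) / h) ^ 1| * (V / c)) := by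
      intro j
      unfold localWeight
      rw [← mul_sub, abs_mul, abs_of_nonneg hnh, sub_sub_sub_comm, ← sub_mul, ← sub_mul]
      gcongr
      exact abs_mul_sub_mul_le (hpV 2 le_rfl) (hpV 1 (by norm_num))
    refine (Finset.sum_le_sum fun j _ => h1 j).trans ?_
    rw [← Finset.mul_sum, Finset.sum_add_distrib, ← Finset.sum_mul, ← Finset.sum_mul, mul_add,
      ← mul_assoc, ← mul_assoc]
    have hx' : ∀ j, |u j - z - (x j - z)| ≤ ε := fun j => by
      rw [sub_sub_sub_cancel_right]; exact hx j
    have h2 := mul_le_mul_of_nonneg_right (hQ 0 (by norm_num) z _ hx') hVc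
    have h3 := mul_le_mul_of_nonneg_right (hQ 1 (by norm_num) z _ hx') hVc
    linarith
  · have hQ0 : 0 ≤ Q := (abs_nonneg _).trans (hvQ 0 (by norm_num) z z' hzz')
    have hdz := hd z hz
    have hdz' := hd z' hz'
    have hdd : |scaledDet K h u z' - scaledDet K h u z| ≤ 4 * V * Q := by
      have e : scaledDet K h u z' - scaledDet K h u z =
          -((scaledMoment K h u 0 z - scaledMoment K h u 0 z') * scaledMoment K h u 2 z' +
          scaledMoment K h u 0 z * (scaledMoment K h u 2 z - scaledMoment K h u 2 z') +
          -((scaledMoment K h u 1 z - scaledMoment K h u 1 z') *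
            (scaledMoment K h u 1 z + scaledMoment K h u 1 z'))) := by
        unfold scaledDet; ring
      rw [e, abs_neg]
      refine (abs_add_three _ _ _).trans ?_
      rw [abs_neg, abs_mul, abs_mul, abs_mul]
      have h1 := mul_le_mul (hvQ 0 (by norm_num) z z' hzz') (hvV 2 le_rfl z') (abs_nonneg _) hQ0
      have h2 := mul_le_mul (hvV 0 (by norm_num) z) (hvQ 2 le_rfl z z' hzz') (abs_nonneg _) hV0
      have h3 := mul_le_mul (hvQ 1 (by norm_num) z z' hzz')
        ((abs_add_le _ _).trans (add_le_add (hvV 1 (by norm_num) z) (hvV 1 (by norm_num) z')))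
        (abs_nonneg _) hQ0
      linarith
    have hΔ : ∀ r ≤ 2, |scaledMoment K h u r z / scaledDet K h u z -
        scaledMoment K h u r z' / scaledDet K h u z'| ≤ (1 / c + 4 * V ^ 2 / c ^ 2) * Q := by
      intro r hr
      have hd0 := hc.trans_le hdz
      have hd0' := hc.trans_le hdz'
      have e : scaledMoment K h u r z / scaledDet K h u z -
          scaledMoment K h u r z' / scaledDet K h u z' =
          (scaledMoment K h u r z - scaledMoment K h u r z') / scaledDet K h u z +
          scaledMoment K h u r z' * (scaledDet K h u z' - scaledDet K h u z) /
            (scaledDet K h u z * scaledDet K h u z') := by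
        field_simp; ring
      rw [e]
      refine (abs_add_le _ _).trans ?_
      rw [abs_div, abs_div, abs_mul, abs_of_pos hd0, abs_of_pos (mul_pos hd0 hd0')]
      have h1 := div_le_div₀ hQ0 (hvQ r hr z z' hzz') hc hdz
      have h2 := div_le_div₀ (by positivity)
        (mul_le_mul (hvV r hr z') hdd (abs_nonneg _) hV0) (mul_pos hc hc)
        (mul_le_mul hdz hdz' hc.le hd0.le)
      refine (add_le_add h1 h2).trans_eq ?_
      field_simp
    have h1 : ∀ j, |localWeight K h u z (u j) - localWeight K h u z' (u j)| ≤
        1 / (n * h) * ((|K ((u j - z) / h) * ((u j - z) / h) ^ 0 -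
            K ((u j - z') / h) * ((u j - z') / h) ^ 0| * (V / c) +
          |K ((u j - z) / h) * ((u j - z) / h) ^ 1 -
            K ((u j - z') / h) * ((u j - z') / h) ^ 1| * (V / c)) +
          (|K ((u j - z') / h) * ((u j - z') / h) ^ 0| * ((1 / c + 4 * V ^ 2 / c ^ 2) * Q) +
          |K ((u j - z') / h) * ((u j - z') / h) ^ 1| * ((1 / c + 4 * V ^ 2 / c ^ 2) * Q))) := by
      intro j
      unfold localWeight
      rw [← mul_sub, abs_mul, abs_of_nonneg hnh]
      gcongr
      generalize K ((u j - z) / h) * ((u j - z) / h) ^ 0 = a0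
      generalize K ((u j - z') / h) * ((u j - z') / h) ^ 0 = b0
      generalize K ((u j - z) / h) * ((u j - z) / h) ^ 1 = a1
      generalize K ((u j - z') / h) * ((u j - z') / h) ^ 1 = b1
      have g1 := hpV 1 (by norm_num)
      have g2 := hpV 2 le_rfl
      have g3 := hΔ 1 (by norm_num)
      have g4 := hΔ 2 le_rfl
      generalize scaledMoment K h u 1 z / scaledDet K h u z = p1 at *
      generalize scaledMoment K h u 2 z / scaledDet K h u z = p2 at *
      generalize scaledMoment K h u 1 z' / scaledDet K h u z' = r1 at *
      generalize scaledMoment K h u 2 z' / scaledDet K h u z' = r2 at *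
      -- First the window factors change with the coefficients at z frozen, then the coefficients
      -- change.
      have e : a0 * p2 - a1 * p1 - (b0 * r2 - b1 * r1) =
          ((a0 - b0) * p2 - (a1 - b1) * p1) + (b0 * (p2 - r2) - b1 * (p1 - r1)) := by ring
      rw [e]
      refine (abs_add_le _ _).trans (add_le_add (abs_mul_sub_mul_le g2 g1)
        (abs_mul_sub_mul_le g4 g3))
    refine (Finset.sum_le_sum fun j _ => h1 j).trans ?_
    rw [← Finset.mul_sum, Finset.sum_add_distrib, Finset.sum_add_distrib, Finset.sum_add_distrib,
      ← Finset.sum_mul, ← Finset.sum_mul, ← Finset.sum_mul, ← Finset.sum_mul, mul_add, mul_add,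
      mul_add, ← mul_assoc, ← mul_assoc, ← mul_assoc, ← mul_assoc]
    have hx' : ∀ j, |u j - z - (u j - z')| ≤ ε := fun j => by
      rw [show u j - z - (u j - z') = -(z - z') by ring, abs_neg]; exact hzz'
    have hE : 0 ≤ (1 / c + 4 * V ^ 2 / c ^ 2) * Q := by positivity
    have h2 := mul_le_mul_of_nonneg_right (hQ 0 (by norm_num) z _ hx') hVc
    have h3 := mul_le_mul_of_nonneg_right (hQ 1 (by norm_num) z _ hx') hVc
    have h4 := mul_le_mul_of_nonneg_right (hV 0 (by norm_num) z') hE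
    have h5 := mul_le_mul_of_nonneg_right (hV 1 (by norm_num) z') hE
    linarith

end Smoother

/-- A symmetric K vanishing on [0, 1) would be zero almost everywhere, against ∫ K = 1; a positive
value at some x < 1 persists nearby by the Lipschitz bound. The length 3γ leaves room for two
intervals of length γ with a gap γ between them. -/
theorem exists_le_on_Icc {K : ℝ → ℝ} (hK0 : ∀ u, 0 ≤ K u) (hKsymm : ∀ u, K (-u) = K u)
    (hKsupp : ∀ u, 1 < |u| → K u = 0) (hKint : ∫ u, K u = 1) {B : ℝ} (hKB : IsWindow B K) :
    ∃ κ α γ : ℝ, 0 < κ ∧ 0 ≤ α ∧ 0 < γ ∧ α + 3 * γ ≤ 1 ∧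
      ∀ x, α ≤ x → x ≤ α + 3 * γ → κ ≤ K x := by
  have hex : ∃ x, 0 ≤ x ∧ x < 1 ∧ 0 < K x := by
    by_contra! hc
    have hz : ∀ x, |x| ≠ 1 → K x = 0 := by
      intro x hx
      rcases lt_or_gt_of_ne hx with h | h
      · have h1 : K |x| = K x := by
          rcases abs_choice x with h | h <;> rw [h]
          exact hKsymm x
        rw [← h1]
        exact le_antisymm (hc _ (abs_nonneg x) h) (hK0 _)
      · exact hKsupp x h
    have hae : K =ᵐ[volume] 0 := by
      have : ∀ᵐ x : ℝ, x ∉ ({1, -1} : Set ℝ) :=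
        measure_eq_zero_iff_ae_notMem.1 ((Set.toFinite _).measure_zero volume)
      filter_upwards [this] with x hx
      refine hz x fun h => hx ?_
      rcases eq_or_eq_neg_of_abs_eq h with h | h <;> simp [h]
    rw [integral_congr_ae hae] at hKint
    simp at hKint
  obtain ⟨x, hx0, hx1, hKx⟩ := hex
  -- The first bound keeps x + 3δ ≤ 1, the second makes the drop B · 3δ at most K x / 2.
  set δ := min ((1 - x) / 3) (K x / (6 * (B + 1))) with hδ
  have hB := hKB.nonneg
  have hδ0 : 0 < δ := lt_min (by linarith) (by positivity)
  have hδ1 : δ ≤ (1 - x) / 3 := min_le_left _ _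
  have hδ2 : δ * (6 * (B + 1)) ≤ K x := (le_div_iff₀ (by positivity)).1 (min_le_right _ _)
  refine ⟨K x / 2, x, δ, by linarith, hx0, hδ0, by linarith, fun y hy1 hy2 => ?_⟩
  have h1 := hKB.abs_sub_le x y (by rw [abs_le]; constructor <;> linarith)
    (by rw [abs_le]; constructor <;> linarith)
  have h2 : |x - y| ≤ 3 * δ := by rw [abs_le]; constructor <;> linarith
  have h3 : B * |x - y| ≤ B * (3 * δ) := by gcongr
  have h4 := (abs_le.1 (h1.trans h3)).2
  nlinarith

/-- The bounds on the entries of a smoother matrix at the design points `w` that make products of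
smoother matrices nearly constant in the row index. -/
structure IsRegularSmoother {n : ℕ} (C : ℝ) (q : ℕ) (h : ℝ) (w : Fin n → ℝ)
    (S : Matrix (Fin n) (Fin n) ℝ) : Prop where
  row_sum_abs_le : ∀ i, ∑ j, |S i j| ≤ C
  row_sum : ∀ i, ∑ j, S i j = 1
  row_sub_le : ∀ i i', level q (w i) = level q (w i') → ∑ j, |S i j - S i' j| ≤ C * (1 / (q * h))
  exists_step : ∀ i, ∃ D : ℕ → ℝ, (∀ c, |D c| ≤ C / (n * h)) ∧
    ∑ j, |S i j - D (level q (w j))| ≤ C * (1 / (q * h))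

/-- The level counts of the design determine all the estimates, with constants that depend only on
K, B, λ and D; boundary points need no special treatment because a one-sided window suffices for the
determinant. -/
theorem exists_isRegularSmoother {K : ℝ → ℝ} (hK0 : ∀ u, 0 ≤ K u) (hKsymm : ∀ u, K (-u) = K u)
    (hKsupp : ∀ u, 1 < |u| → K u = 0) (hKint : ∫ u, K u = 1) {B : ℝ} (hKB : IsWindow B K)
    {lam D : ℝ} (hlam : 0 < lam) (hD0 : 0 ≤ D) :
    ∃ C ε : ℝ, 0 < ε ∧ ∀ (n q : ℕ) (h : ℝ) (u : Fin n → ℝ), 0 < q → (q : ℝ) ^ 2 ≤ 2 * n →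
      (n : ℝ) ≤ 2 * lam * q ^ 2 → 0 < h → h ≤ 1 / 2 → 1 / (q * h) ≤ ε →
      (∀ i, u i ∈ Set.Icc (0 : ℝ) 1) →
      ∑ c ∈ Finset.range q, |(levelCount q u c : ℝ) - lam * q| ≤ D * q →
      (∀ i, localDet K h u (u i) ≠ 0) ∧ IsRegularSmoother C q h u (smoother K h u) := by
  obtain ⟨κ, α, γ, hκ, hα, hγ, hαγ, hκK⟩ := exists_le_on_Icc hK0 hKsymm hKsupp hKint hKB
  have hB0 := hKB.nonneg
  set A := 2 * lam + D with hA
  have hA0 : 0 ≤ A := by positivity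
  set V := 6 * (4 * B) * A with hV
  have hV0 : 0 ≤ V := by positivity
  set c := (γ / 4 * κ * γ) ^ 2 / 2 with hcdef
  have hc : 0 < c := by positivity
  set C1 := 2 * (4 * B) * (V / c)
  set C2 := 2 * V * (V / c)
  set C3 := 2 * (V / c) * (18 * (4 * B) * A)
  set C4 := 2 * (V / c + V * (1 / c + 4 * V ^ 2 / c ^ 2)) * (18 * (4 * B) * A)
  have h1 : 0 ≤ C1 := by positivity
  have h2 : 0 ≤ C2 := by positivity
  have h3 : 0 ≤ C3 := by positivity
  have h4 : 0 ≤ C4 := by positivity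
  -- The bound 1 gives qh ≥ 1. The other makes the counting error (2λ + D)q at most half of the main
  -- term λq²hγ for an interval of length hγ.
  refine ⟨C1 + C2 + C3 + C4, min 1 (γ * lam / (4 * lam + 2 * D)), by positivity, ?_⟩
  intro n q h u hq hqn hnq hh hh2 hqh hu hcnt
  have hq' : (0 : ℝ) < q := by exact_mod_cast hq
  have hn' : (0 : ℝ) < n := by nlinarith
  have hn : 0 < n := by exact_mod_cast hn'
  have hqh1 : 1 ≤ q * h := by
    have := hqh.trans (min_le_left _ _)
    rwa [div_le_one (by positivity)] at this
  have hqh2 : 4 * lam + 2 * D ≤ γ * lam * (q * h) := by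
    have := hqh.trans (min_le_right _ _)
    rwa [div_le_div_iff₀ (by positivity) (by positivity), one_mul] at this
  have hcount : ∀ s t, s ≤ t →
      ((Finset.univ.filter fun i => s ≤ u i ∧ u i ≤ t).card : ℝ) ≤
        A * (q * (q * (t - s) + 1)) := fun s t hst =>
    card_Icc_filter_le hq hu hlam.le hD0 hcnt hst
  have hlow : ∀ s, 0 ≤ s → s + h * γ ≤ 1 → γ / 4 * (n * h) ≤
      ((Finset.univ.filter fun i => s ≤ u i ∧ u i ≤ s + h * γ).card : ℝ) := by
    intro s hs ht
    refine le_trans ?_ (le_card_Icc_filter hq hu hlam.le hcnt hs ht)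
    have g1 : γ / 4 * (n * h) ≤ γ / 4 * ((2 * lam * q ^ 2) * h) := by gcongr
    nlinarith
  have hd : ∀ z ∈ Set.Icc (0 : ℝ) 1, c ≤ scaledDet K h u z := by
    intro z hz
    have hhγ : 0 ≤ h * γ := by positivity
    have hhα : 0 ≤ h * α := by positivity
    have hhh : h * (α + 3 * γ) ≤ 1 / 2 := by nlinarith
    -- As h ≤ 1/2, the half window pointing towards the farther end of [0, 1] stays inside; its
    -- intervals at scaled distances [α, α + γ] and [α + 2γ, α + 3γ] from z serve as I and J.
    rcases le_or_gt z (1 / 2) with hz2 | hz2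
    · refine le_scaledDet hh hn hK0 hκ.le hγ.le (by positivity)
        (I := Finset.univ.filter fun i => z + h * α ≤ u i ∧ u i ≤ z + h * α + h * γ)
        (J := Finset.univ.filter fun i => z + h * (α + 2 * γ) ≤ u i ∧
          u i ≤ z + h * (α + 2 * γ) + h * γ) ?_ ?_ ?_ ?_ ?_
      · intro i hi
        have hi' := (Finset.mem_filter.1 hi).2
        refine hκK _ ?_ ?_
        · rw [le_div_iff₀ hh]; linarith
        · rw [div_le_iff₀ hh]; linarith
      · intro i hi
        have hi' := (Finset.mem_filter.1 hi).2
        refine hκK _ ?_ ?_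
        · rw [le_div_iff₀ hh]; linarith
        · rw [div_le_iff₀ hh]; linarith
      · intro i hi j hj
        have hi' := (Finset.mem_filter.1 hi).2
        have hj' := (Finset.mem_filter.1 hj).2
        rw [abs_sub_comm, ← sub_div]
        refine le_trans ?_ (le_abs_self _)
        rw [le_div_iff₀ hh]; linarith
      · exact hlow _ (by linarith [hz.1]) (by linarith)
      · exact hlow _ (by linarith [hz.1]) (by linarith)
    · refine le_scaledDet hh hn hK0 hκ.le hγ.le (by positivity)
        (I := Finset.univ.filter fun i => z - h * (α + γ) ≤ u i ∧ u i ≤ z - h * (α + γ) + h * γ)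
        (J := Finset.univ.filter fun i => z - h * (α + 3 * γ) ≤ u i ∧
          u i ≤ z - h * (α + 3 * γ) + h * γ) ?_ ?_ ?_ ?_ ?_
      · intro i hi
        have hi' := (Finset.mem_filter.1 hi).2
        rw [← hKsymm, ← neg_div]
        refine hκK _ ?_ ?_
        · rw [le_div_iff₀ hh]; linarith
        · rw [div_le_iff₀ hh]; linarith
      · intro i hi
        have hi' := (Finset.mem_filter.1 hi).2
        rw [← hKsymm, ← neg_div]
        refine hκK _ ?_ ?_
        · rw [le_div_iff₀ hh]; linarith
        · rw [div_le_iff₀ hh]; linarith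
      · intro i hi j hj
        have hi' := (Finset.mem_filter.1 hi).2
        have hj' := (Finset.mem_filter.1 hj).2
        rw [← sub_div]
        refine le_trans ?_ (le_abs_self _)
        rw [le_div_iff₀ hh]; linarith
      · exact hlow _ (by linarith) (by linarith [hz.2])
      · exact hlow _ (by linarith) (by linarith [hz.2])
  have hW : ∀ r ≤ 2, IsWindow (4 * B) fun x => K x * x ^ r := by
    intro r hr
    refine (hKB.mul_pow r).mono ?_
    gcongr
    calc (2 : ℝ) ^ r ≤ 2 ^ 2 := by gcongr; norm_num
      _ = 4 := by norm_num
  have hb := fun z hz => localWeight_bounds (n := n) (u := u) (K := K) (h := h) (c := c) (z := z)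
    (fun r hr => (hW r hr).abs_le) hh hc hV0 hd
    (fun r hr z => (hW r hr).sum_abs_le hA0 hcount hq hqn hh hqh1 z)
    (fun r hr z x hx => (hW r hr).sum_abs_sub_le hA0 hcount hq hqn hh hqh1 z x hx) hz
  have hε : 0 ≤ 1 / (q * h) := by positivity
  refine ⟨fun i => ?_, fun i => ?_, fun i => ?_, fun i i' hi => ?_, fun i => ?_⟩
  · rw [localDet_eq hh.ne']
    exact mul_ne_zero (by positivity) (hc.trans_le (hd _ (hu i))).ne'
  · simp_rw [smoother_apply hh.ne']
    refine (hb _ (hu i)).2.1.trans ?_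
    linarith
  · simp_rw [smoother_apply hh.ne']
    exact sum_localWeight (hc.trans_le (hd _ (hu i))).ne'
  · simp_rw [smoother_apply hh.ne']
    refine ((hb _ (hu i)).2.2.2 (u i') (hu i') (abs_sub_le_of_level_eq hq (hu i) (hu i') hi)).trans ?_
    rw [← mul_assoc]
    gcongr
    linarith
  -- The step function takes the weight at the left endpoint c / q of each level.
  · refine ⟨fun c => localWeight K h u (u i) (c / q), fun c => ?_, ?_⟩
    · refine ((hb _ (hu i)).1 _).trans ?_
      gcongr
      linarith
    · simp_rw [smoother_apply hh.ne']
      refine ((hb _ (hu i)).2.2.1 (fun j => level q (u j) / q)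
        fun j => abs_sub_level_div_le hq (hu j)).trans ?_
      rw [← mul_assoc]
      gcongr
      linarith

/-! ### Products of smoother matrices -/

theorem centred_apply {n : ℕ} (S : Matrix (Fin n) (Fin n) ℝ) (i j : Fin n) :
    centred S i j = S i j - 1 / n * ∑ k, S k j := by
  unfold centred
  rw [sub_mul, one_mul, Matrix.sub_apply, Matrix.smul_mul, Matrix.smul_apply, Matrix.mul_apply,
    smul_eq_mul]
  simp

/-- S fixes constant vectors, so S times the matrix of column means of T has constant columns, which
the outer centring annihilates. -/
theorem centred_mul_centred {n : ℕ} (S T : Matrix (Fin n) (Fin n) ℝ) (hS : ∀ i, ∑ j, S i j = 1) :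
    centred S * centred T = centred (S * T) := by
  ext i j
  have hn : (n : ℝ) ≠ 0 := by
    have := i.pos
    positivity
  have h1 : ∀ i, ∑ k, S i k * (1 / n * ∑ l, T l j) = 1 / n * ∑ l, T l j := by
    intro i; rw [← Finset.sum_mul, hS, one_mul]
  have h2 : ∀ i, (S * centred T) i j = (S * T) i j - 1 / n * ∑ l, T l j := by
    intro i
    simp_rw [Matrix.mul_apply, centred_apply, mul_sub, Finset.sum_sub_distrib]
    rw [h1]
  have h3 : centred S * centred T = centred (S * centred T) := by
    unfold centred; rw [Matrix.mul_assoc]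
  rw [h3, centred_apply, centred_apply]
  simp_rw [h2, Finset.sum_sub_distrib]
  rw [Finset.sum_const, Finset.card_univ, Fintype.card_fin, nsmul_eq_mul]
  field_simp
  ring

theorem rowSumNorm_le {n : ℕ} {A : Matrix (Fin n) (Fin n) ℝ} {R : ℝ} (hR : 0 ≤ R)
    (h : ∀ i, ∑ j, |A i j| ≤ R) : rowSumNorm A ≤ R := by
  unfold rowSumNorm
  rw [Matrix.linfty_opNorm_def]
  lift R to ℝ≥0 using hR
  rw [NNReal.coe_le_coe]
  refine Finset.sup_le fun i _ => ?_
  rw [← NNReal.coe_le_coe]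
  push_cast
  simpa using h i

theorem rowSumNorm_nonneg {n : ℕ} (A : Matrix (Fin n) (Fin n) ℝ) : 0 ≤ rowSumNorm A := by
  unfold rowSumNorm
  rw [Matrix.linfty_opNorm_def]
  exact NNReal.coe_nonneg _

/-- A row of the centred matrix is the average of its differences from all rows. -/
theorem rowSumNorm_centred_le {n : ℕ} {A : Matrix (Fin n) (Fin n) ℝ} {R : ℝ} (hR : 0 ≤ R)
    (h : ∀ i i', ∑ j, |A i j - A i' j| ≤ R) : rowSumNorm (centred A) ≤ R := by
  refine rowSumNorm_le hR fun i => ?_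
  have hn : (0 : ℝ) < n := by
    have := i.pos
    positivity
  have h1 : ∀ j, |centred A i j| ≤ 1 / n * ∑ i', |A i j - A i' j| := by
    intro j
    have h2 : centred A i j = 1 / n * ∑ i', (A i j - A i' j) := by
      rw [centred_apply, Finset.sum_sub_distrib, Finset.sum_const, Finset.card_univ,
        Fintype.card_fin, nsmul_eq_mul]
      field_simp
    rw [h2, abs_mul, abs_of_nonneg (by positivity)]
    gcongr
    exact Finset.abs_sum_le_sum_abs _ _
  refine (Finset.sum_le_sum fun j _ => h1 j).trans ?_
  rw [← Finset.mul_sum, Finset.sum_comm]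
  have h3 := Finset.sum_le_card_nsmul Finset.univ (fun i' => ∑ j, |A i j - A i' j|) R
    fun i' _ => h i i'
  rw [Finset.card_univ, Fintype.card_fin, nsmul_eq_mul] at h3
  rw [one_div, inv_mul_le_iff₀ hn]
  exact h3

theorem sum_abs_sum_mul_le {ι κ : Type*} [Fintype κ] (T : Finset ι) (x : ι → ℝ) (y : ι → κ → ℝ)
    {X Y : ℝ} (hX : ∑ i ∈ T, |x i| ≤ X) (hY0 : 0 ≤ Y) (hY : ∀ i ∈ T, ∑ j, |y i j| ≤ Y) :
    ∑ j, |∑ i ∈ T, x i * y i j| ≤ X * Y := by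
  calc ∑ j, |∑ i ∈ T, x i * y i j| ≤ ∑ j, ∑ i ∈ T, |x i| * |y i j| := by
        refine Finset.sum_le_sum fun j _ => (Finset.abs_sum_le_sum_abs _ _).trans_eq ?_
        simp_rw [abs_mul]
    _ = ∑ i ∈ T, |x i| * ∑ j, |y i j| := by
        rw [Finset.sum_comm]
        simp_rw [Finset.mul_sum]
    _ ≤ ∑ i ∈ T, |x i| * Y := Finset.sum_le_sum fun i hi => by
        have := hY i hi
        gcongr
    _ ≤ X * Y := by
        rw [← Finset.sum_mul]
        gcongr

theorem sum_comp_prod {n : ℕ} {κ : Type*} [DecidableEq κ] (g : Fin n → κ) (T : Finset κ)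
    (hT : ∀ i, g i ∈ T) (F : κ → ℝ) :
    ∑ i, F (g i) = ∑ c ∈ T, ((Finset.univ.filter fun i => g i = c).card : ℝ) * F c := by
  rw [← Finset.sum_fiberwise_of_maps_to (t := T) (g := g) fun i _ => hT i]
  refine Finset.sum_congr rfl fun c _ => ?_
  rw [← nsmul_eq_mul, ← Finset.sum_const]
  exact Finset.sum_congr rfl fun i hi => by rw [(Finset.mem_filter.1 hi).2]

/-- The rows of a product of smoother matrices in two predictors differ little if nearly all cells
of the grid contain the same number of points. -/
theorem sum_abs_mul_sub_mul_le {n q : ℕ} {C D lam h₁ h₂ : ℝ} {w₁ w₂ : Fin n → ℝ}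
    {S₁ S₂ : Matrix (Fin n) (Fin n) ℝ} (hS₁ : IsRegularSmoother C q h₁ w₁ S₁)
    (hS₂ : IsRegularSmoother C q h₂ w₂ S₂) (hq : 0 < q) (hqn : (q : ℝ) ^ 2 ≤ 2 * n)
    (hh₁ : 0 < h₁) (hh₂ : 0 < h₂) (hqh₁ : 1 / (q * h₁) ≤ 1)
    (hD : ∑ c ∈ Finset.range q ×ˢ Finset.range q,
      |((Finset.univ.filter fun i => (level q (w₁ i), level q (w₂ i)) = c).card : ℝ) - lam| ≤ D * q)
    (i i' : Fin n) :
    ∑ j, |(S₁ * S₂) i j - (S₁ * S₂) i' j| ≤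
      (4 + 8 * D) * C ^ 2 * (1 / (q * h₁) + 1 / (q * h₂)) := by
  classical
  have hq' : (0 : ℝ) < q := by exact_mod_cast hq
  have hn' : (0 : ℝ) < n := by nlinarith
  have hC : 0 ≤ C := (Finset.sum_nonneg fun j _ => abs_nonneg _).trans (hS₁.row_sum_abs_le i)
  have hDq : 0 ≤ D * q := (Finset.sum_nonneg fun j _ => abs_nonneg _).trans hD
  have hD0 : 0 ≤ D := nonneg_of_mul_nonneg_left hDq hq'
  set l₁ := fun k => level q (w₁ k)
  set l₂ := fun k => level q (w₂ k)
  have hl₁ : ∀ k, l₁ k ∈ Finset.range q := fun k => Finset.mem_range.2 (level_lt hq _)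
  have hl₂ : ∀ k, l₂ k ∈ Finset.range q := fun k => Finset.mem_range.2 (level_lt hq _)
  set ε₁ := 1 / (q * h₁) with hε₁
  set ε₂ := 1 / (q * h₂) with hε₂
  have hε₁0 : 0 ≤ ε₁ := by positivity
  have hε₂0 : 0 ≤ ε₂ := by positivity
  set m := fun c : ℕ × ℕ => ((Finset.univ.filter fun k => (l₁ k, l₂ k) = c).card : ℝ) with hm
  set T := Finset.range q ×ˢ Finset.range q
  obtain ⟨Da, hDa, hDa'⟩ := hS₁.exists_step i
  obtain ⟨Db, hDb, hDb'⟩ := hS₁.exists_step i'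
  set d := fun k => S₁ i k - S₁ i' k with hd
  set E := fun c => Da c - Db c with hE
  have hEb : ∀ c, |E c| ≤ 2 * (C / (n * h₁)) := fun c =>
    (abs_sub _ _).trans (by linarith [hDa c, hDb c])
  have hdE : ∑ k, |d k - E (l₁ k)| ≤ 2 * C * ε₁ := by
    have : ∀ k, |d k - E (l₁ k)| ≤ |S₁ i k - Da (l₁ k)| + |S₁ i' k - Db (l₁ k)| := by
      intro k
      rw [show d k - E (l₁ k) = (S₁ i k - Da (l₁ k)) - (S₁ i' k - Db (l₁ k)) by simp only [hd, hE]; ring]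
      exact abs_sub _ _
    refine (Finset.sum_le_sum fun k _ => this k).trans ?_
    rw [Finset.sum_add_distrib]
    linarith
  have hd1 : ∑ k, |d k| ≤ 2 * C := by
    refine (Finset.sum_le_sum fun k _ => abs_sub _ _).trans ?_
    rw [Finset.sum_add_distrib]
    linarith [hS₁.row_sum_abs_le i, hS₁.row_sum_abs_le i']
  have hd0 : ∑ k, d k = 0 := by
    simp only [hd]
    rw [Finset.sum_sub_distrib, hS₁.row_sum, hS₁.row_sum, sub_self]
  have hE1 : ∑ k, |E (l₁ k)| ≤ 2 * C + 2 * C * ε₁ := by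
    have : ∀ k, |E (l₁ k)| ≤ |d k| + |d k - E (l₁ k)| := by
      intro k
      have := abs_sub (d k) (d k - E (l₁ k))
      rwa [sub_sub_cancel] at this
    refine (Finset.sum_le_sum fun k _ => this k).trans ?_
    rw [Finset.sum_add_distrib]
    linarith
  have hE0 : |∑ k, E (l₁ k)| ≤ 2 * C * ε₁ := by
    rw [show ∑ k, E (l₁ k) = -∑ k, (d k - E (l₁ k)) by
      rw [Finset.sum_sub_distrib d, hd0, zero_sub, neg_neg], abs_neg]
    exact (Finset.abs_sum_le_sum_abs _ _).trans hdE
  -- One representative row of S₂ per level. On empty levels the value 0 keeps the ℓ¹ bound and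
  -- changes no sum over points.
  set F : ℕ → Fin n → ℝ := fun c j => if hc : ∃ k, l₂ k = c then S₂ hc.choose j else 0 with hF
  have hF1 : ∀ c, ∑ j, |F c j| ≤ C := by
    intro c
    by_cases hc : ∃ k, l₂ k = c
    · simp only [hF, dif_pos hc]
      exact hS₂.row_sum_abs_le _
    · simp only [hF, dif_neg hc, abs_zero, Finset.sum_const_zero]
      exact hC
  have hSF : ∀ k, ∑ j, |S₂ k j - F (l₂ k) j| ≤ C * ε₂ := by
    intro k
    have hc : ∃ k', l₂ k' = l₂ k := ⟨k, rfl⟩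
    simp only [hF, dif_pos hc]
    exact hS₂.row_sub_le _ _ hc.choose_spec.symm
  -- The total count deviation Dq meets entries of size C/(nh₁), and q/n ≤ 2/q.
  have hqn' : D * q * (2 * (C / (n * h₁))) ≤ 4 * C * D * ε₁ := by
    have e1 : D * q * (2 * (C / (n * h₁))) = 2 * C * D * (1 / h₁) * (q / n) := by field_simp
    have e2 : 4 * C * D * ε₁ = 2 * C * D * (1 / h₁) * (2 / q) := by rw [hε₁]; field_simp; ring
    rw [e1, e2]
    gcongr ?_ * ?_
    rw [div_le_div_iff₀ hn' hq']
    linarith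
  have hmE : ∑ c ∈ T, |(m c - lam) * E c.1| ≤ 4 * C * D * ε₁ := by
    refine le_trans ?_ hqn'
    refine le_trans ?_ (mul_le_mul_of_nonneg_right hD (by positivity))
    rw [Finset.sum_mul]
    refine Finset.sum_le_sum fun c _ => ?_
    rw [abs_mul]
    exact mul_le_mul_of_nonneg_left (hEb _) (abs_nonneg _)
  have hcomp : ∀ G : ℕ × ℕ → ℝ, ∑ k, G (l₁ k, l₂ k) = ∑ c ∈ T, m c * G c := fun G =>
    sum_comp_prod (fun k => (l₁ k, l₂ k)) T (fun k => Finset.mem_product.2 ⟨hl₁ k, hl₂ k⟩) G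
  -- λq Σ E differs from Σ_k E(l₁ k) by the count deviation, and the latter is near Σ_k d k = 0
  -- because both rows of S₁ sum to 1.
  have hsumE : |lam * q * ∑ c ∈ Finset.range q, E c| ≤ 2 * C * ε₁ + 4 * C * D * ε₁ := by
    have e1 : lam * q * ∑ c ∈ Finset.range q, E c =
        ∑ k, E (l₁ k) - ∑ c ∈ T, (m c - lam) * E c.1 := by
      rw [hcomp fun c => E c.1, ← Finset.sum_sub_distrib]
      simp_rw [← sub_mul, sub_sub_cancel]
      rw [← Finset.mul_sum, Finset.sum_product]
      simp only [Finset.sum_const, Finset.card_range, nsmul_eq_mul]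
      rw [← Finset.mul_sum, mul_assoc]
    rw [e1]
    exact (abs_sub _ _).trans (add_le_add hE0 ((Finset.abs_sum_le_sum_abs _ _).trans hmE))
  -- Four errors: the step approximation of the rows of S₁, the representatives for the rows of S₂,
  -- the product term for equally filled cells (small because Σ E is), and the deviation of the cell
  -- counts from λ.
  have hsplit : ∀ j, (S₁ * S₂) i j - (S₁ * S₂) i' j =
      ∑ k, (d k - E (l₁ k)) * S₂ k j + ∑ k, E (l₁ k) * (S₂ k j - F (l₂ k) j) +
      (∑ c ∈ Finset.range q, (lam * ∑ c ∈ Finset.range q, E c) * F c j +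
        ∑ c ∈ T, ((m c - lam) * E c.1) * F c.2 j) := by
    intro j
    have e1 : ∑ k, E (l₁ k) * F (l₂ k) j =
        ∑ c ∈ Finset.range q, (lam * ∑ c ∈ Finset.range q, E c) * F c j +
        ∑ c ∈ T, ((m c - lam) * E c.1) * F c.2 j := by
      rw [hcomp fun c => E c.1 * F c.2 j, ← Finset.mul_sum, mul_assoc, Finset.sum_mul_sum,
        ← Finset.sum_product', Finset.mul_sum, ← Finset.sum_add_distrib]
      exact Finset.sum_congr rfl fun c _ => by ring
    rw [← e1, Matrix.mul_apply, Matrix.mul_apply, ← Finset.sum_sub_distrib,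
      ← Finset.sum_add_distrib, ← Finset.sum_add_distrib]
    exact Finset.sum_congr rfl fun k _ => by simp only [hd]; ring
  have b1 := sum_abs_sum_mul_le Finset.univ (fun k => d k - E (l₁ k)) (fun k j => S₂ k j) hdE hC
    fun k _ => hS₂.row_sum_abs_le k
  have b2 := sum_abs_sum_mul_le Finset.univ (fun k => E (l₁ k)) (fun k j => S₂ k j - F (l₂ k) j)
    hE1 (by positivity) fun k _ => hSF k
  have b3 := sum_abs_sum_mul_le (Finset.range q) (fun _ => lam * ∑ c ∈ Finset.range q, E c) F
    (X := 2 * C * ε₁ + 4 * C * D * ε₁) (by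
      refine le_trans (le_of_eq ?_) hsumE
      rw [Finset.sum_const, Finset.card_range, nsmul_eq_mul, mul_right_comm, abs_mul _ (q : ℝ),
        abs_of_pos hq', mul_comm]) hC fun c _ => hF1 c
  have b4 := sum_abs_sum_mul_le T (fun c => (m c - lam) * E c.1) (fun c j => F c.2 j) hmE hC
    fun c _ => hF1 c.2
  have htot : ∑ j, |(S₁ * S₂) i j - (S₁ * S₂) i' j| ≤
      2 * C * ε₁ * C + (2 * C + 2 * C * ε₁) * (C * ε₂) +
      ((2 * C * ε₁ + 4 * C * D * ε₁) * C + 4 * C * D * ε₁ * C) := by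
    refine le_trans ?_ (add_le_add (add_le_add b1 b2) (add_le_add b3 b4))
    simp_rw [← Finset.sum_add_distrib]
    refine Finset.sum_le_sum fun j _ => ?_
    rw [hsplit]
    refine (abs_add_le _ _).trans (add_le_add (abs_add_le _ _) (abs_add_le _ _))
  refine htot.trans ?_
  -- The mixed term is absorbed by ε₁ ≤ 1, so the coefficients are 4 + 8D for ε₁ and 4 for ε₂.
  have e1 : C ^ 2 * ε₂ * ε₁ ≤ C ^ 2 * ε₂ * 1 := by gcongr
  have e2 : 0 ≤ C ^ 2 * D * ε₂ := by positivity
  nlinarith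

/-! ### Convergence of backfitting -/

theorem mulVec_subMean {n : ℕ} {A : Matrix (Fin n) (Fin n) ℝ} (hA : ∀ i, ∑ j, A i j = 0)
    (y m : Fin n → ℝ) : A.mulVec (subMean y - m) = A.mulVec (y - m) := by
  have h1 : subMean y - m = (y - m) - fun _ => 1 / (n : ℝ) * ∑ j, y j := by
    ext i; simp [subMean]; ring
  have h2 : A.mulVec (fun _ => 1 / (n : ℝ) * ∑ j, y j) = 0 := by
    ext i
    simp only [Matrix.mulVec, dotProduct]
    rw [← Finset.sum_mul, hA, zero_mul, Pi.zero_apply]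
  rw [h1, Matrix.mulVec_sub, h2, sub_zero]

theorem sum_centred_row {n : ℕ} {S : Matrix (Fin n) (Fin n) ℝ} (hS : ∀ i, ∑ j, S i j = 1)
    (i : Fin n) : ∑ j, centred S i j = 0 := by
  have hn : (n : ℝ) ≠ 0 := by
    have := i.pos
    positivity
  simp_rw [centred_apply, Finset.sum_sub_distrib]
  rw [← Finset.mul_sum, Finset.sum_comm]
  simp_rw [hS]
  simp [hn]

section BackfittingNorm

attribute [local instance] Matrix.linftyOpNormedAddCommGroup

theorem dist_mulVec_le {n : ℕ} (A : Matrix (Fin n) (Fin n) ℝ) (v w : Fin n → ℝ) :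
    dist (A.mulVec v) (A.mulVec w) ≤ rowSumNorm A * dist v w := by
  rw [dist_eq_norm, dist_eq_norm, ← Matrix.mulVec_sub]
  exact Matrix.linfty_opNorm_mulVec A _

end BackfittingNorm

/-- With m₁ = g m₂ eliminated, a cycle maps m₂ to f m₂, where f is affine with linear part A₂A₁, a
contraction in the sup norm. Zero row sums make the subtraction of the mean irrelevant, so fixed
points solve the equations with y itself. -/
theorem backfittingConverges_of_rowSumNorm_lt {n : ℕ} {A₁ A₂ : Matrix (Fin n) (Fin n) ℝ}
    (hA₁ : ∀ i, ∑ j, A₁ i j = 0) (hA₂ : ∀ i, ∑ j, A₂ i j = 0)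
    (h : rowSumNorm (A₂ * A₁) < 1) : BackfittingConverges A₁ A₂ := by
  intro y
  set g : (Fin n → ℝ) → (Fin n → ℝ) := fun m => A₁.mulVec (y - m) with hg
  set f : (Fin n → ℝ) → (Fin n → ℝ) := fun m => A₂.mulVec (y - g m) with hf
  have hstep : ∀ m, backfitStep A₁ A₂ y m = (g m.2, f m.2) := by
    intro m
    simp only [backfitStep, mulVec_subMean hA₁, mulVec_subMean hA₂, hg, hf]
  have hgc : Continuous g := by
    simp only [hg]
    exact Continuous.matrix_mulVec continuous_const (continuous_const.sub continuous_id)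
  have hfc : ContractingWith (rowSumNorm (A₂ * A₁)).toNNReal f := by
    refine ⟨Real.toNNReal_lt_one.2 h, LipschitzWith.of_dist_le_mul fun m m' => ?_⟩
    have h1 : ∀ m, f m = A₂.mulVec (y - A₁.mulVec y) + (A₂ * A₁).mulVec m := by
      intro m
      simp only [hf, hg]
      rw [← Matrix.mulVec_mulVec, ← Matrix.mulVec_add, Matrix.mulVec_sub A₁,
        sub_sub_eq_add_sub, sub_add_eq_add_sub]
    rw [h1, h1, dist_add_left, Real.coe_toNNReal _ (rowSumNorm_nonneg _)]
    exact dist_mulVec_le _ _ _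
  set p := ContractingWith.fixedPoint f hfc with hp
  have hpf : f p = p := hfc.fixedPoint_isFixedPt
  refine ⟨(g p, p), fun m' => ⟨fun hm => ?_, fun hm => ?_⟩, fun m₀ => ?_⟩
  · obtain ⟨h1, h2⟩ := hm
    have h1' : m'.1 = g m'.2 := by
      simp only [hg, Matrix.mulVec_sub]; exact eq_sub_of_add_eq h1
    have h2' : f m'.2 = m'.2 := by
      simp only [hf]
      rw [← h1', Matrix.mulVec_sub, ← h2, add_sub_cancel_left]
    have h3 : m'.2 = p := hfc.fixedPoint_unique h2'
    rw [← h3, ← h1']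
  · rw [hm]
    constructor
    · simp only [hg, Matrix.mulVec_sub, sub_add_cancel]
    · change A₂.mulVec (g p) + p = A₂.mulVec y
      have : f p = A₂.mulVec y - A₂.mulVec (g p) := by simp only [hf, Matrix.mulVec_sub]
      rw [hpf] at this
      rw [eq_sub_iff_add_eq'] at this
      exact this
  -- The starting m₁ is forgotten after one cycle, and m₁ is computed from the m₂ of the previous
  -- cycle; hence the shift by one.
  · have hit : ∀ r, (backfitStep A₁ A₂ y)^[r + 1] m₀ = (g (f^[r] m₀.2), f^[r + 1] m₀.2) := by
      intro r
      induction r with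
      | zero => simp [hstep]
      | succ r ih =>
        rw [Function.iterate_succ_apply', ih, hstep, Function.iterate_succ_apply' f (r + 1)]
    rw [← tendsto_add_atTop_iff_nat 1]
    simp_rw [hit]
    have ht := hfc.tendsto_iterate_fixedPoint m₀.2
    exact ((hgc.tendsto p).comp ht).prodMk_nhds ((tendsto_add_atTop_iff_nat 1).2 ht)

/-! ### Smoothing on IES subsamples of rich data -/

/-- The cell of the `q × q` grid that contains the point `v`. -/
def cell (q : ℕ) (v : Fin 2 → ℝ) : ℕ × ℕ := (level q (v 0), level q (v 1))

theorem levelCount_fst_eq {n q : ℕ} (hq : 0 < q) (u : Fin n → Fin 2 → ℝ) (c : ℕ) :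
    levelCount q (fun i => u i 0) c = ∑ b ∈ Finset.range q, cellCount q u (c, b) := by
  unfold levelCount cellCount
  rw [Finset.card_eq_sum_card_fiberwise (f := fun i => level q (u i 1)) (t := Finset.range q)
    fun i _ => Finset.mem_coe.2 (Finset.mem_range.2 (level_lt hq _))]
  refine Finset.sum_congr rfl fun b _ => ?_
  rw [Finset.filter_filter]
  simp

theorem levelCount_snd_eq {n q : ℕ} (hq : 0 < q) (u : Fin n → Fin 2 → ℝ) (c : ℕ) :
    levelCount q (fun i => u i 1) c = ∑ a ∈ Finset.range q, cellCount q u (a, c) := by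
  unfold levelCount cellCount
  rw [Finset.card_eq_sum_card_fiberwise (f := fun i => level q (u i 0)) (t := Finset.range q)
    fun i _ => Finset.mem_coe.2 (Finset.mem_range.2 (level_lt hq _))]
  refine Finset.sum_congr rfl fun b _ => ?_
  rw [Finset.filter_filter]
  simp [and_comm]

theorem sum_abs_levelCount_sub_le {n q : ℕ} (hq : 0 < q) (u : Fin n → Fin 2 → ℝ) (lam : ℝ)
    (t : Fin 2) :
    ∑ c ∈ Finset.range q, |(levelCount q (fun i => u i t) c : ℝ) - lam * q| ≤
      ∑ c ∈ Finset.range q ×ˢ Finset.range q, |(cellCount q u c : ℝ) - lam| := by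
  have hlam : lam * q = ∑ _b ∈ Finset.range q, lam := by simp [mul_comm]
  fin_cases t
  · rw [Finset.sum_product]
    refine Finset.sum_le_sum fun c _ => ?_
    have h := levelCount_fst_eq hq u c
    simp only [Fin.zero_eta, Fin.isValue]
    rw [h, hlam, Nat.cast_sum, ← Finset.sum_sub_distrib]
    exact Finset.abs_sum_le_sum_abs _ _
  · rw [Finset.sum_product_right]
    refine Finset.sum_le_sum fun c _ => ?_
    have h := levelCount_snd_eq hq u c
    simp only [Fin.mk_one, Fin.isValue]
    rw [h, hlam, Nat.cast_sum, ← Finset.sum_sub_distrib]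
    exact Finset.abs_sum_le_sum_abs _ _

/-- Every cell of the grid contains at least `m` of the points `x 0, …, x (N - 1)`. -/
def IsRich (m q N : ℕ) (x : ℕ → Fin 2 → ℝ) : Prop :=
  ∀ c ∈ Finset.range q ×ˢ Finset.range q, ∃ φ : Fin m → ℕ, Function.Injective φ ∧
    ∀ k, φ k < N ∧ cell q (x (φ k)) = c

/-- Index i takes point number i / q² of its diagonal cell; n ≤ m q² means that no cell is asked for
more than m points. -/
theorem IsRich.exists_subsample {n m q N : ℕ} {x : ℕ → Fin 2 → ℝ} (hx : IsRich m q N x)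
    (hq : 0 < q) (hn : n ≤ m * (q * q)) :
    ∃ s : Fin n → ℕ, IsSubsample N s ∧ ∀ i, cell q (x (s i)) = diagonalCell q i := by
  have hmem : ∀ i, diagonalCell q i ∈ Finset.range q ×ˢ Finset.range q := fun i =>
    Finset.mem_product.2 ⟨Finset.mem_range.2 (Nat.mod_lt _ hq), Finset.mem_range.2 (Nat.mod_lt _ hq)⟩
  choose φ hφ hφ' using hx
  have hlt : ∀ i : Fin n, (i : ℕ) / (q * q) < m := fun i =>
    (Nat.div_lt_iff_lt_mul (by positivity)).2 (i.2.trans_le hn)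
  refine ⟨fun i => φ _ (hmem i) ⟨i / (q * q), hlt i⟩, ⟨fun i i' h => ?_, fun i => (hφ' _ _ _).1⟩,
    fun i => (hφ' _ _ _).2⟩
  have hc : diagonalCell q i = diagonalCell q i' := by
    rw [← (hφ' _ (hmem i) ⟨i / (q * q), hlt i⟩).2, ← (hφ' _ (hmem i') ⟨i' / (q * q), hlt i'⟩).2]
    exact congrArg (fun k => cell q (x k)) h
  have hd : (i : ℕ) / (q * q) = i' / (q * q) := by
    have h' : φ _ (hmem i) ⟨i / (q * q), hlt i⟩ = φ _ (hmem i) ⟨i' / (q * q), hlt i'⟩ := by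
      refine h.trans ?_
      simp only [← hc]
    simpa using hφ _ _ h'
  exact Fin.ext (eq_of_diagonalCell_eq hq hd hc)

/-- On an IES subsample of rich data the local linear smoothers are well defined, and the products
of the centred smoother matrices are small. -/
theorem exists_rowSumNorm_le {K : ℝ → ℝ} (hK0 : ∀ u, 0 ≤ K u) (hKsymm : ∀ u, K (-u) = K u)
    (hKsupp : ∀ u, 1 < |u| → K u = 0) (hKint : ∫ u, K u = 1) {B : ℝ} (hKB : IsWindow B K)
    {lam : ℕ} (hlam : 1 ≤ lam) (C : ℕ) :
    ∃ R ε : ℝ, 0 < ε ∧ ∀ (n q N : ℕ) (h : Fin 2 → ℝ) (x : ℕ → Fin 2 → ℝ) (s : Fin n → ℕ),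
      2 * C < q → |(n : ℝ) - lam * q ^ 2| ≤ C * q → (∀ t, 0 < h t) → (∀ t, h t ≤ 1 / 2) →
      (∀ t, 1 / (q * h t) ≤ ε) → (∀ k < N, ∀ t, x k t ∈ Set.Icc (0 : ℝ) 1) →
      IsRich (lam + 1) q N x → IsIESSubsample q N x s →
      (∀ t i, localDet K (h t) (fun j => x (s j) t) (x (s i) t) ≠ 0) ∧
      rowSumNorm (centredSmoother K (h 0) x s 0 * centredSmoother K (h 1) x s 1) ≤
        R * (1 / (q * h 0) + 1 / (q * h 1)) ∧
      rowSumNorm (centredSmoother K (h 1) x s 1 * centredSmoother K (h 0) x s 0) ≤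
        R * (1 / (q * h 0) + 1 / (q * h 1)) ∧
      (R * (1 / (q * h 0) + 1 / (q * h 1)) < 1 →
        BackfittingConverges (centredSmoother K (h 0) x s 0) (centredSmoother K (h 1) x s 1)) := by
  have hlam' : (1 : ℝ) ≤ lam := by exact_mod_cast hlam
  set D : ℝ := (C + 1) ^ 2 + C with hD
  obtain ⟨C', ε, hε, H⟩ := exists_isRegularSmoother hK0 hKsymm hKsupp hKint hKB
    (lam := lam) (D := D) (by linarith) (by positivity)
  refine ⟨(4 + 8 * D) * C' ^ 2, min 1 ε, by positivity, ?_⟩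
  intro n q N h x s hCq hn hh hh2 hqh hx hrich hs
  have hq : 0 < q := by omega
  have hq' : (0 : ℝ) < q := by exact_mod_cast hq
  have hCq' : 2 * (C : ℝ) ≤ q := by exact_mod_cast hCq.le
  have hn' := abs_le.1 hn
  -- All three size bounds follow from Cq ≤ q²/2 and λ ≥ 1.
  have hqn : (q : ℝ) ^ 2 ≤ 2 * n := by nlinarith
  have hnq : (n : ℝ) ≤ 2 * lam * q ^ 2 := by nlinarith
  have hnq' : n ≤ (lam + 1) * (q * q) := by
    rify
    nlinarith
  set u := fun i => x (s i) with hu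
  have hu01 : ∀ i t, u i t ∈ Set.Icc (0 : ℝ) 1 := fun i t => hx _ (hs.1.2 i) t
  obtain ⟨s', hs', hcell⟩ := hrich.exists_subsample hq hnq'
  -- Minimality enters only here, through comparison with the diagonal subsample.
  have hcnt := sum_abs_cellCount_sub_le (by omega) hlam hn u (fun i => x (s' i)) hcell (hs.2 s' hs')
  have hreg : ∀ t, (∀ i, localDet K (h t) (fun j => u j t) (u i t) ≠ 0) ∧
      IsRegularSmoother C' q (h t) (fun j => u j t) (smoother K (h t) fun j => u j t) := fun t =>
    H n q (h t) (fun j => u j t) hq hqn hnq (hh t) (hh2 t) ((hqh t).trans (min_le_right _ _))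
      (fun i => hu01 i t) ((sum_abs_levelCount_sub_le hq u lam t).trans hcnt)
  have hswap : ∑ c ∈ Finset.range q ×ˢ Finset.range q,
      |((Finset.univ.filter fun i => (level q (u i 1), level q (u i 0)) = c).card : ℝ) - lam| ≤
        D * q := by
    refine le_trans (le_of_eq ?_) hcnt
    refine Finset.sum_nbij' Prod.swap Prod.swap ?_ ?_ ?_ ?_ ?_
    · simp +contextual
    · simp +contextual
    · simp
    · simp
    · rintro ⟨c, c'⟩ _
      simp [cellCount, and_comm]
  have hε1 : ∀ t, 1 / (q * h t) ≤ 1 := fun t => (hqh t).trans (min_le_left _ _)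
  have hR0 : 0 ≤ (4 + 8 * D) * C' ^ 2 * (1 / (q * h 0) + 1 / (q * h 1)) := by
    have := hh 0
    have := hh 1
    positivity
  have h01 : rowSumNorm (centredSmoother K (h 0) x s 0 * centredSmoother K (h 1) x s 1) ≤
      (4 + 8 * D) * C' ^ 2 * (1 / (q * h 0) + 1 / (q * h 1)) := by
    unfold centredSmoother
    rw [centred_mul_centred _ _ (hreg 0).2.row_sum]
    exact rowSumNorm_centred_le hR0 (sum_abs_mul_sub_mul_le (hreg 0).2 (hreg 1).2 hq hqn (hh 0)
      (hh 1) (hε1 0) hcnt)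
  have h10 : rowSumNorm (centredSmoother K (h 1) x s 1 * centredSmoother K (h 0) x s 0) ≤
      (4 + 8 * D) * C' ^ 2 * (1 / (q * h 0) + 1 / (q * h 1)) := by
    unfold centredSmoother
    rw [centred_mul_centred _ _ (hreg 1).2.row_sum]
    refine rowSumNorm_centred_le hR0 fun i i' => ?_
    rw [add_comm (1 / (q * h 0))]
    exact sum_abs_mul_sub_mul_le (hreg 1).2 (hreg 0).2 hq hqn (hh 1) (hh 0) (hε1 1) hswap i i'
  exact ⟨fun t => (hreg t).1, h01, h10, fun hlt => backfittingConverges_of_rowSumNorm_lt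
    (sum_centred_row (hreg 0).2.row_sum) (sum_centred_row (hreg 1).2.row_sum) (h10.trans_lt hlt)⟩

/-! ### The full data are rich with high probability -/

/-- The half-open square that makes up the cell `c` of the `q × q` grid. -/
def gridBox (q : ℕ) (c : ℕ × ℕ) : Set (Fin 2 → ℝ) :=
  Set.univ.pi fun t => Set.Ico ((![c.1, c.2] t : ℕ) / q : ℝ) (((![c.1, c.2] t : ℕ) + 1) / q)

theorem measurableSet_gridBox (q : ℕ) (c : ℕ × ℕ) : MeasurableSet (gridBox q c) :=
  MeasurableSet.univ_pi fun _ => measurableSet_Ico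

theorem level_eq_of_mem_Ico {q c : ℕ} (hc : c < q) {w : ℝ}
    (hw : w ∈ Set.Ico ((c : ℝ) / q) ((c + 1) / q)) : level q w = c := by
  have hq' : (0 : ℝ) < q := by exact_mod_cast (by omega : 0 < q)
  have h1 : ⌊(q : ℝ) * w⌋₊ = c := by
    have h2 := hw.1
    have h3 := hw.2
    rw [div_le_iff₀ hq'] at h2
    rw [lt_div_iff₀ hq'] at h3
    have h4 : (0 : ℝ) ≤ c := Nat.cast_nonneg c
    rw [Nat.floor_eq_iff (by linarith)]
    constructor <;> linarith
  unfold level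
  omega

/-- The converse fails for last levels, which also contain the coordinate 1; richness needs only
lower bounds on counts, so the smaller box suffices. -/
theorem cell_eq_of_mem_gridBox {q : ℕ} {c : ℕ × ℕ}
    (hc : c ∈ Finset.range q ×ˢ Finset.range q) {v : Fin 2 → ℝ} (hv : v ∈ gridBox q c) :
    cell q v = c := by
  simp only [Finset.mem_product, Finset.mem_range] at hc
  have h0 := hv 0 (Set.mem_univ _)
  have h1 := hv 1 (Set.mem_univ _)
  exact Prod.ext (level_eq_of_mem_Ico hc.1 h0) (level_eq_of_mem_Ico hc.2 h1)

theorem gridBox_subset_Icc {q : ℕ} {c : ℕ × ℕ} (hc : c ∈ Finset.range q ×ˢ Finset.range q) :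
    gridBox q c ⊆ Set.Icc (0 : Fin 2 → ℝ) 1 := by
  simp only [Finset.mem_product, Finset.mem_range] at hc
  have hq' : (0 : ℝ) < q := by exact_mod_cast (by omega : 0 < q)
  have key : ∀ (d : ℕ) (w : ℝ), d < q → w ∈ Set.Ico ((d : ℝ) / q) ((d + 1) / q) → 0 ≤ w ∧ w ≤ 1 := by
    intro d w hd hw
    refine ⟨le_trans (by positivity) hw.1, hw.2.le.trans ?_⟩
    rw [div_le_one hq']
    exact_mod_cast hd
  intro v hv
  have h0 := key _ _ hc.1 (hv 0 (Set.mem_univ _))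
  have h1 := key _ _ hc.2 (hv 1 (Set.mem_univ _))
  constructor <;> intro t <;> fin_cases t
  exacts [h0.1, h1.1, h0.2, h1.2]

theorem volume_gridBox {q : ℕ} (hq : 0 < q) (c : ℕ × ℕ) :
    volume (gridBox q c) = ENNReal.ofReal (1 / (q : ℝ) ^ 2) := by
  have hq' : (0 : ℝ) < q := by exact_mod_cast hq
  unfold gridBox
  rw [Real.volume_pi_Ico]
  have h1 : ∀ x : ℝ, (x + 1) / q - x / q = 1 / q := fun x => by ring
  simp_rw [h1]
  rw [Finset.prod_const, Finset.card_univ, Fintype.card_fin, ← ENNReal.ofReal_pow (by positivity),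
    one_div_pow]

section Probability

variable {Ω : Type*} [MeasurableSpace Ω] {P : Measure Ω}
  {X : ℕ → Ω → Fin 2 → ℝ} {f : (Fin 2 → ℝ) → ℝ} {a : ℝ}

theorem ofReal_le_measure_gridBox (hXmeas : ∀ k, Measurable (X k))
    (hXlaw : ∀ k, P.map (X k) =
      (volume.restrict (Set.Icc (0 : Fin 2 → ℝ) 1)).withDensity fun u => ENNReal.ofReal (f u))
    (ha : 0 ≤ a) (hfa : ∀ u ∈ Set.Icc (0 : Fin 2 → ℝ) 1, a ≤ f u)
    {q : ℕ} {c : ℕ × ℕ} (hc : c ∈ Finset.range q ×ˢ Finset.range q) (k : ℕ) :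
    ENNReal.ofReal (a * (1 / (q : ℝ) ^ 2)) ≤ P (X k ⁻¹' gridBox q c) := by
  have hq : 0 < q := by
    simp only [Finset.mem_product, Finset.mem_range] at hc; omega
  have hm := measurableSet_gridBox q c
  rw [← Measure.map_apply (hXmeas k) hm, hXlaw, withDensity_apply _ hm,
    Measure.restrict_restrict hm, Set.inter_eq_left.2 (gridBox_subset_Icc hc)]
  calc ENNReal.ofReal (a * (1 / (q : ℝ) ^ 2)) = ∫⁻ _ in gridBox q c, ENNReal.ofReal a := by
        rw [setLIntegral_const, volume_gridBox hq, ENNReal.ofReal_mul ha]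
    _ ≤ ∫⁻ u in gridBox q c, ENNReal.ofReal (f u) :=
        setLIntegral_mono' hm fun u hu => ENNReal.ofReal_le_ofReal (hfa u (gridBox_subset_Icc hc hu))

/-- Each point hits the box with probability at least a/q²; independence and 1 - p ≤ exp(-p) give
the bound. -/
theorem measure_forall_notMem_gridBox_le [IsProbabilityMeasure P]
    (hXmeas : ∀ k, Measurable (X k)) (hXindep : iIndepFun X P)
    (hXlaw : ∀ k, P.map (X k) =
      (volume.restrict (Set.Icc (0 : Fin 2 → ℝ) 1)).withDensity fun u => ENNReal.ofReal (f u))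
    (ha : 0 ≤ a) (hfa : ∀ u ∈ Set.Icc (0 : Fin 2 → ℝ) 1, a ≤ f u)
    {q : ℕ} {c : ℕ × ℕ} (hc : c ∈ Finset.range q ×ˢ Finset.range q) (J : Finset ℕ) :
    P {ω | ∀ k ∈ J, X k ω ∉ gridBox q c} ≤
      ENNReal.ofReal (Real.exp (-(a * (1 / (q : ℝ) ^ 2) * J.card))) := by
  have hm := measurableSet_gridBox q c
  have h1 : {ω | ∀ k ∈ J, X k ω ∉ gridBox q c} = ⋂ k ∈ J, X k ⁻¹' (gridBox q c)ᶜ := by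
    ext ω; simp
  rw [h1, hXindep.measure_inter_preimage_eq_mul J fun _ _ => hm.compl]
  have h2 : ∀ k ∈ J, P (X k ⁻¹' (gridBox q c)ᶜ) ≤
      ENNReal.ofReal (Real.exp (-(a * (1 / (q : ℝ) ^ 2)))) := by
    intro k _
    rw [Set.preimage_compl, prob_compl_eq_one_sub (hXmeas k hm)]
    refine (tsub_le_tsub_left (ofReal_le_measure_gridBox hXmeas hXlaw ha hfa hc k) 1).trans ?_
    rw [← ENNReal.ofReal_one, ← ENNReal.ofReal_sub _ (by positivity)]
    exact ENNReal.ofReal_le_ofReal (Real.one_sub_le_exp_neg _)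
  refine (Finset.prod_le_prod' h2).trans_eq ?_
  rw [Finset.prod_const, ← ENNReal.ofReal_pow (Real.exp_pos _).le, ← Real.exp_nat_mul]
  congr 2
  ring

/-- Hits from m disjoint index blocks are automatically distinct, so binomial tail estimates are
avoided. -/
theorem isRich_of_forall_exists {m q N : ℕ} (x : ℕ → Fin 2 → ℝ)
    (hx : ∀ c ∈ Finset.range q ×ˢ Finset.range q, ∀ l < m,
      ∃ k ∈ Finset.Ico (l * (N / m)) ((l + 1) * (N / m)), x k ∈ gridBox q c) :
    IsRich m q N x := by
  intro c hc
  have hx' : ∀ l : Fin m, ∃ k ∈ Finset.Ico (l * (N / m)) ((l + 1) * (N / m)), x k ∈ gridBox q c :=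
    fun l => hx c hc l l.2
  choose φ hφ hφ' using hx'
  simp only [Finset.mem_Ico] at hφ
  refine ⟨φ, fun l l' h => ?_, fun l => ⟨?_, cell_eq_of_mem_gridBox hc (hφ' l)⟩⟩
  · have h1 := hφ l
    have h2 := hφ l'
    rw [h] at h1
    have h3 : (l : ℕ) < l' + 1 := lt_of_mul_lt_mul_right (h1.1.trans_lt h2.2) (Nat.zero_le _)
    have h4 : (l' : ℕ) < l + 1 := lt_of_mul_lt_mul_right (h2.1.trans_lt h1.2) (Nat.zero_le _)
    exact Fin.ext (by omega)
  · refine (hφ l).2.trans_le (le_trans (Nat.mul_le_mul_right _ l.2) ?_)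
    exact Nat.mul_div_le N m

theorem measure_not_isRich_le [IsProbabilityMeasure P]
    (hXmeas : ∀ k, Measurable (X k)) (hXindep : iIndepFun X P)
    (hXlaw : ∀ k, P.map (X k) =
      (volume.restrict (Set.Icc (0 : Fin 2 → ℝ) 1)).withDensity fun u => ENNReal.ofReal (f u))
    (ha : 0 ≤ a) (hfa : ∀ u ∈ Set.Icc (0 : Fin 2 → ℝ) 1, a ≤ f u) (m q N : ℕ) :
    P {ω | ¬ IsRich m q N fun k => X k ω} ≤
      ENNReal.ofReal (m * q ^ 2 * Real.exp (-(a * (1 / (q : ℝ) ^ 2) * (N / m : ℕ)))) := by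
  have hsub : {ω | ¬ IsRich m q N fun k => X k ω} ⊆
      ⋃ c ∈ Finset.range q ×ˢ Finset.range q, ⋃ l ∈ Finset.range m,
        {ω | ∀ k ∈ Finset.Ico (l * (N / m)) ((l + 1) * (N / m)), X k ω ∉ gridBox q c} := by
    intro ω hω
    by_contra hc
    simp only [Set.mem_iUnion, Set.mem_ofPred_eq, not_exists, not_forall, not_not] at hc
    refine hω (isRich_of_forall_exists _ fun c hcm l hl => ?_)
    obtain ⟨k, hk, hk'⟩ := hc c hcm l (Finset.mem_range.2 hl)
    exact ⟨k, hk, hk'⟩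
  refine (measure_mono hsub).trans ?_
  have h1 : ∀ c ∈ Finset.range q ×ˢ Finset.range q, ∀ l ∈ Finset.range m,
      P {ω | ∀ k ∈ Finset.Ico (l * (N / m)) ((l + 1) * (N / m)), X k ω ∉ gridBox q c} ≤
        ENNReal.ofReal (Real.exp (-(a * (1 / (q : ℝ) ^ 2) * (N / m : ℕ)))) := by
    intro c hc l _
    refine (measure_forall_notMem_gridBox_le hXmeas hXindep hXlaw ha hfa hc _).trans_eq ?_
    rw [Nat.card_Ico, ← Nat.sub_mul, Nat.add_sub_cancel_left, one_mul]
  refine (measure_biUnion_finset_le _ _).trans ?_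
  refine (Finset.sum_le_sum fun c hc => (measure_biUnion_finset_le _ _).trans
    (Finset.sum_le_sum (h1 c hc))).trans_eq ?_
  rw [Finset.sum_const, Finset.sum_const, Finset.card_product, Finset.card_range, Finset.card_range,
    nsmul_eq_mul, nsmul_eq_mul, ENNReal.ofReal_mul (by positivity), ENNReal.ofReal_mul (by positivity),
    ENNReal.ofReal_natCast, ENNReal.ofReal_pow (by positivity), ENNReal.ofReal_natCast]
  push_cast
  ring

theorem ae_mem_Icc (hXmeas : ∀ k, Measurable (X k))
    (hXlaw : ∀ k, P.map (X k) =
      (volume.restrict (Set.Icc (0 : Fin 2 → ℝ) 1)).withDensity fun u => ENNReal.ofReal (f u)) :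
    ∀ᵐ ω ∂P, ∀ k, X k ω ∈ Set.Icc (0 : Fin 2 → ℝ) 1 := by
  rw [ae_all_iff]
  intro k
  refine ae_of_ae_map (p := fun v => v ∈ Set.Icc (0 : Fin 2 → ℝ) 1) (hXmeas k).aemeasurable ?_
  rw [hXlaw]
  exact (withDensity_absolutelyContinuous _ _).ae_le (ae_restrict_mem measurableSet_Icc)

theorem tendsto_measure_not_isRich [IsProbabilityMeasure P]
    (hXmeas : ∀ k, Measurable (X k)) (hXindep : iIndepFun X P)
    (hXlaw : ∀ k, P.map (X k) =
      (volume.restrict (Set.Icc (0 : Fin 2 → ℝ) 1)).withDensity fun u => ENNReal.ofReal (f u))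
    (ha : 0 < a) (hfa : ∀ u ∈ Set.Icc (0 : Fin 2 → ℝ) 1, a ≤ f u) {m : ℕ} (hm : 0 < m)
    {q : ℕ → ℕ} {ν C : ℝ} (hν1 : ν < 1) (hC : 0 < C) (hq : ∀ᶠ N in atTop, 0 < q N)
    (hqN : ∀ᶠ N : ℕ in atTop, (q N : ℝ) ^ 2 ≤ C * (N : ℝ) ^ ν) :
    Tendsto (fun N => P {ω | ¬ IsRich m (q N) N fun k => X k ω}) atTop (𝓝 0) := by
  have hm' : (0 : ℝ) < m := by exact_mod_cast hm
  have hν : 0 < 1 - ν := by linarith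
  -- The 2 pays for rounding: N / m as a natural number is at least N/(2m) once N ≥ 2m.
  set b := a / (2 * m * C) with hb
  have hb0 : 0 < b := by positivity
  -- N^ν is written as a power of t = N^(1-ν), so that the bound has the form t^r exp(-bt).
  have hlim : Tendsto (fun N : ℕ => m * C * (((N : ℝ) ^ (1 - ν)) ^ (ν / (1 - ν)) *
      Real.exp (-b * (N : ℝ) ^ (1 - ν)))) atTop (𝓝 0) := by
    rw [← mul_zero (m * C)]
    refine Tendsto.const_mul _ ?_
    exact (tendsto_rpow_mul_exp_neg_mul_atTop_nhds_zero (ν / (1 - ν)) b hb0).comp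
      ((tendsto_rpow_atTop hν).comp tendsto_natCast_atTop_atTop)
  have hlim' := ENNReal.tendsto_ofReal hlim
  rw [ENNReal.ofReal_zero] at hlim'
  refine tendsto_of_tendsto_of_tendsto_of_le_of_le' tendsto_const_nhds hlim'
    (Eventually.of_forall fun _ => zero_le) ?_
  filter_upwards [hq, hqN, eventually_ge_atTop (2 * m)] with N hq hqN hN
  refine (measure_not_isRich_le hXmeas hXindep hXlaw ha.le hfa m (q N) N).trans
    (ENNReal.ofReal_le_ofReal ?_)
  have hq' : (0 : ℝ) < q N := by exact_mod_cast hq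
  have hN0 : (0 : ℝ) < N := by exact_mod_cast (by omega : 0 < N)
  have e1 : ((N : ℝ) ^ (1 - ν)) ^ (ν / (1 - ν)) = (N : ℝ) ^ ν := by
    rw [← Real.rpow_mul hN0.le, mul_div_cancel₀ _ hν.ne']
  have e2 : (N : ℝ) / (2 * m) ≤ (N / m : ℕ) := by
    have h1 : N < (N / m + 1) * m := by
      have := Nat.lt_div_mul_add (a := N) hm
      nlinarith
    have h2 : 2 ≤ N / m := (Nat.le_div_iff_mul_le hm).2 hN
    have h3 : N ≤ N / m * (2 * m) := by nlinarith
    rw [div_le_iff₀ (by positivity)]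
    exact_mod_cast h3
  have e3 : b * (N : ℝ) ^ (1 - ν) ≤ a * (1 / (q N : ℝ) ^ 2) * (N / m : ℕ) := by
    have h1 : (N : ℝ) ^ (1 - ν) = N / (N : ℝ) ^ ν := by rw [Real.rpow_sub hN0, Real.rpow_one]
    have hNν : 0 < (N : ℝ) ^ ν := Real.rpow_pos_of_pos hN0 _
    have h2 : b * (N : ℝ) ^ (1 - ν) = a * (1 / (C * (N : ℝ) ^ ν)) * (N / (2 * m)) := by
      rw [h1, hb]; field_simp
    rw [h2]
    gcongr
  have e4 : (m : ℝ) * (q N) ^ 2 ≤ m * C * (N : ℝ) ^ ν := by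
    rw [mul_assoc]
    gcongr
  rw [e1, ← mul_assoc]
  exact mul_le_mul e4 (Real.exp_le_exp.2 (by linarith)) (Real.exp_pos _).le (by positivity)

end Probability

/-! ### Asymptotics of the levels and bandwidths, and the final assembly -/

/-- Eventually n ≤ λq² + Cq ≤ (λ + C)q², so n cannot tend to infinity while q stays below b. -/
theorem tendsto_atTop_levels {n q : ℕ → ℕ} {lam C : ℕ}
    (hn : Tendsto n atTop atTop)
    (hnq : ∀ᶠ N in atTop, |(n N : ℝ) - lam * (q N : ℝ) ^ 2| ≤ C * q N) :
    Tendsto q atTop atTop := by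
  rw [tendsto_atTop]
  intro b
  filter_upwards [hnq, tendsto_atTop.1 hn ((lam + C) * b ^ 2 + 1)] with N h1 h2
  by_contra! hb
  have h3 : (n N : ℝ) ≤ lam * (q N : ℝ) ^ 2 + C * q N := by linarith [(abs_le.1 h1).2]
  have h4 : n N ≤ lam * q N ^ 2 + C * q N := by exact_mod_cast h3
  have h5 : q N ≤ q N ^ 2 := Nat.le_self_pow (by norm_num) _
  have h6 : q N ^ 2 ≤ b ^ 2 := Nat.pow_le_pow_left hb.le 2
  have h7 : (lam + C) * q N ^ 2 ≤ (lam + C) * b ^ 2 := Nat.mul_le_mul_left _ h6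
  have h8 : C * q N ≤ C * q N ^ 2 := Nat.mul_le_mul_left _ h5
  linarith

theorem tendsto_one_div_mul_bandwidth {q : ℕ → ℕ} {h : ℕ → ℝ} (hhpos : ∀ N, 0 < h N)
    (hh0 : Tendsto h atTop (𝓝 0))
    (hqh : Tendsto (fun N => 1 / ((q N : ℝ) * h N ^ 2)) atTop (𝓝 0)) :
    Tendsto (fun N => 1 / ((q N : ℝ) * h N)) atTop (𝓝 0) := by
  have h1 := hqh.mul hh0
  rw [mul_zero] at h1
  refine h1.congr fun N => ?_
  have := (hhpos N).ne'
  rw [pow_two, ← mul_assoc, ← div_div, div_mul_cancel₀ _ this]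

end IES

end

theorem mainTheorem4
    {Ω : Type*} [MeasurableSpace Ω] (P : Measure Ω) [IsProbabilityMeasure P]
    -- i.i.d. bivariate predictors, with a density on the unit square bounded away from 0 and ∞
    (X : ℕ → Ω → Fin 2 → ℝ) (hXmeas : ∀ k, Measurable (X k)) (hXindep : iIndepFun X P)
    (f : (Fin 2 → ℝ) → ℝ) (hf : Measurable f)
    (hXlaw : ∀ k, P.map (X k) =
      (volume.restrict (Set.Icc (0 : Fin 2 → ℝ) 1)).withDensity fun u => ENNReal.ofReal (f u))
    (a b : ℝ) (ha : 0 < a) (hfab : ∀ u ∈ Set.Icc (0 : Fin 2 → ℝ) 1, a ≤ f u ∧ f u ≤ b)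
    -- subsample size `n` and number of levels `q`, as functions of the full sample size `N`
    (n q : ℕ → ℕ) (lam : ℕ) (hlam : 1 ≤ lam)
    (hnq : (fun N => (n N : ℝ) - lam * (q N : ℝ) ^ 2) =O[atTop] fun N => (q N : ℝ))
    (hn : Tendsto n atTop atTop)
    (ν : ℝ) (hν0 : 0 < ν) (hν1 : ν < 1)
    (hnN : (fun N => (n N : ℝ)) =O[atTop] fun N => (N : ℝ) ^ ν)
    -- the kernel: a symmetric density on `[-1,1]`, Lipschitz there
    (K : ℝ → ℝ) (hK0 : ∀ u, 0 ≤ K u) (hKsymm : ∀ u, K (-u) = K u)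
    (hKsupp : ∀ u, 1 < |u| → K u = 0) (hKint : ∫ u, K u = 1)
    (M : ℝ≥0) (hKlip : LipschitzOnWith M K (Set.Icc (-1) 1))
    -- the bandwidths
    (h : Fin 2 → ℕ → ℝ) (hhpos : ∀ t N, 0 < h t N) (hh0 : ∀ t, Tendsto (h t) atTop (𝓝 0))
    (hqh : ∀ t, Tendsto (fun N => 1 / ((q N : ℝ) * h t N ^ 2)) atTop (𝓝 0))
    -- an arbitrary choice of an IES subsample
    (s : ∀ N, Ω → Fin (n N) → ℕ)
    (hs : ∀ N, n N ≤ N → ∀ ω, IES.IsIESSubsample (q N) N (fun k => X k ω) (s N ω)) :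
    -- the local linear smoothers are well defined with probability tending to one
    (∀ t, Tendsto (fun N => P {ω | ¬ ∀ i,
        IES.localDet K (h t N) (fun j => X (s N ω j) ω t) (X (s N ω i) ω t) ≠ 0})
      atTop (𝓝 0)) ∧
    -- `‖S₁* S₂*‖_∞ = o_p(1)` and `‖S₂* S₁*‖_∞ = o_p(1)`
    TendstoInMeasure P (fun N ω => IES.rowSumNorm
        (IES.centredSmoother K (h 0 N) (fun k => X k ω) (s N ω) 0 *
          IES.centredSmoother K (h 1 N) (fun k => X k ω) (s N ω) 1))
      atTop (fun _ => (0 : ℝ)) ∧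
    TendstoInMeasure P (fun N ω => IES.rowSumNorm
        (IES.centredSmoother K (h 1 N) (fun k => X k ω) (s N ω) 1 *
          IES.centredSmoother K (h 0 N) (fun k => X k ω) (s N ω) 0))
      atTop (fun _ => (0 : ℝ)) ∧
    -- backfitting converges to the unique solution with probability tending to one
    Tendsto (fun N => P {ω | ¬ IES.BackfittingConverges
        (IES.centredSmoother K (h 0 N) (fun k => X k ω) (s N ω) 0)
        (IES.centredSmoother K (h 1 N) (fun k => X k ω) (s N ω) 1)})
      atTop (𝓝 0) := by
  obtain ⟨c₀, hc₀⟩ := hnq.bound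
  set C := ⌈c₀⌉₊ with hC
  have hnC : ∀ᶠ N in atTop, |(n N : ℝ) - lam * (q N : ℝ) ^ 2| ≤ C * q N := by
    filter_upwards [hc₀] with N hN
    rw [Real.norm_eq_abs, Real.norm_eq_abs, Nat.abs_cast] at hN
    exact hN.trans (by gcongr; exact Nat.le_ceil _)
  have hq := IES.tendsto_atTop_levels hn hnC
  have hlam' : (1 : ℝ) ≤ lam := by exact_mod_cast hlam
  obtain ⟨c₁, hc₁⟩ := hnN.bound
  have hn1 : ∀ᶠ N : ℕ in atTop, (n N : ℝ) ≤ (|c₁| + 1) * (N : ℝ) ^ ν := by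
    filter_upwards [hc₁] with N hN
    have hpos : 0 ≤ (N : ℝ) ^ ν := Real.rpow_nonneg (Nat.cast_nonneg _) _
    rw [Real.norm_eq_abs, Real.norm_eq_abs, Nat.abs_cast, abs_of_nonneg hpos] at hN
    exact hN.trans (by gcongr; linarith [le_abs_self c₁])
  have hqN : ∀ᶠ N : ℕ in atTop, (q N : ℝ) ^ 2 ≤ 2 * (|c₁| + 1) * (N : ℝ) ^ ν := by
    filter_upwards [hn1, hnC, hq.eventually_ge_atTop (2 * C)] with N h1 h2 h3
    have h3' : 2 * (C : ℝ) ≤ q N := by exact_mod_cast h3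
    have h4 := (abs_le.1 h2).1
    have h5 : (0 : ℝ) ≤ q N := Nat.cast_nonneg _
    nlinarith
  -- Subsamples of size n exist only for n ≤ N, and minimality is assumed only then.
  have hnle : ∀ᶠ N : ℕ in atTop, n N ≤ N := by
    have hlim : Tendsto (fun N : ℕ => (N : ℝ) ^ (1 - ν)) atTop atTop :=
      (tendsto_rpow_atTop (by linarith)).comp tendsto_natCast_atTop_atTop
    filter_upwards [hn1, hlim.eventually_ge_atTop (|c₁| + 1), eventually_gt_atTop 0] with N h1 h2 h3
    have hN0 : (0 : ℝ) < N := by exact_mod_cast h3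
    have h4 : (n N : ℝ) ≤ (N : ℝ) ^ (1 - ν) * (N : ℝ) ^ ν := h1.trans (by gcongr)
    rw [← Real.rpow_add hN0, sub_add_cancel, Real.rpow_one] at h4
    exact_mod_cast h4
  have hε : ∀ t, Tendsto (fun N => 1 / ((q N : ℝ) * h t N)) atTop (𝓝 0) := fun t =>
    IES.tendsto_one_div_mul_bandwidth (hhpos t) (hh0 t) (hqh t)
  obtain ⟨R, ε, hε0, H⟩ := IES.exists_rowSumNorm_le hK0 hKsymm hKsupp hKint
    (IES.isWindow_of_lipschitzOnWith hKsupp hKlip) hlam C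
  have hR : Tendsto (fun N => R * (1 / ((q N : ℝ) * h 0 N) + 1 / ((q N : ℝ) * h 1 N))) atTop
      (𝓝 0) := by
    simpa using ((hε 0).add (hε 1)).const_mul R
  -- One exceptional event serves all four conclusions; its second part is null.
  set bad : ℕ → Set Ω := fun N => {ω | ¬ IES.IsRich (lam + 1) (q N) N fun k => X k ω} ∪
    {ω | ¬ ∀ k, X k ω ∈ Set.Icc (0 : Fin 2 → ℝ) 1}
  have hbad : Tendsto (fun N => P (bad N)) atTop (𝓝 0) := by
    refine tendsto_of_tendsto_of_tendsto_of_le_of_le tendsto_const_nhds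
      (IES.tendsto_measure_not_isRich hXmeas hXindep hXlaw ha (fun u hu => (hfab u hu).1)
        (Nat.succ_pos lam) hν1 (by positivity) (hq.eventually_gt_atTop 0) hqN)
      (fun _ => zero_le) fun N => ?_
    refine (measure_union_le _ _).trans_eq ?_
    rw [ae_iff.1 (IES.ae_mem_Icc hXmeas hXlaw), add_zero]
  -- Monotonicity of P holds for arbitrary sets, so neither E nor the choice of subsample has to be
  -- measurable.
  have hfin : ∀ E : ℕ → Set Ω, (∀ᶠ N in atTop, ∀ ω ∉ bad N, ω ∉ E N) →
      Tendsto (fun N => P (E N)) atTop (𝓝 0) := fun E hE =>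
    tendsto_of_tendsto_of_tendsto_of_le_of_le' tendsto_const_nhds hbad
      (Eventually.of_forall fun _ => zero_le) <| by
        filter_upwards [hE] with N hN
        exact measure_mono fun ω hω => by_contra fun hb => hN ω hb hω
  have hgood : ∀ᶠ N in atTop, ∀ ω ∉ bad N,
      (∀ t i, IES.localDet K (h t N) (fun j => X (s N ω j) ω t) (X (s N ω i) ω t) ≠ 0) ∧
      IES.rowSumNorm (IES.centredSmoother K (h 0 N) (fun k => X k ω) (s N ω) 0 *
        IES.centredSmoother K (h 1 N) (fun k => X k ω) (s N ω) 1) ≤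
          R * (1 / ((q N : ℝ) * h 0 N) + 1 / ((q N : ℝ) * h 1 N)) ∧
      IES.rowSumNorm (IES.centredSmoother K (h 1 N) (fun k => X k ω) (s N ω) 1 *
        IES.centredSmoother K (h 0 N) (fun k => X k ω) (s N ω) 0) ≤
          R * (1 / ((q N : ℝ) * h 0 N) + 1 / ((q N : ℝ) * h 1 N)) ∧
      (R * (1 / ((q N : ℝ) * h 0 N) + 1 / ((q N : ℝ) * h 1 N)) < 1 → IES.BackfittingConverges
        (IES.centredSmoother K (h 0 N) (fun k => X k ω) (s N ω) 0)
        (IES.centredSmoother K (h 1 N) (fun k => X k ω) (s N ω) 1)) := by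
    have hh2 : ∀ᶠ N in atTop, ∀ t, h t N ≤ 1 / 2 := eventually_all.2 fun t =>
      (hh0 t).eventually_le_const (by norm_num)
    have hqε : ∀ᶠ N in atTop, ∀ t, 1 / ((q N : ℝ) * h t N) ≤ ε := eventually_all.2 fun t =>
      (hε t).eventually_le_const hε0
    filter_upwards [hq.eventually_gt_atTop (2 * C), hnC, hh2, hqε, hnle] with N h1 h2 h3 h4 h5 ω hω
    simp only [bad, Set.mem_union, Set.mem_ofPred_eq, not_or, not_not] at hω
    exact H (n N) (q N) N (fun t => h t N) (fun k => X k ω) (s N ω) h1 h2 (fun t => hhpos t N) h3 h4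
      (fun k _ t => ⟨(hω.2 k).1 t, (hω.2 k).2 t⟩) hω.1 (hs N h5 ω)
  have hmeas : ∀ Y : ℕ → Ω → ℝ, (∀ N ω, 0 ≤ Y N ω) → (∀ᶠ N in atTop, ∀ ω ∉ bad N,
      Y N ω ≤ R * (1 / ((q N : ℝ) * h 0 N) + 1 / ((q N : ℝ) * h 1 N))) →
      TendstoInMeasure P Y atTop fun _ => (0 : ℝ) := by
    intro Y hY0 hY
    rw [tendstoInMeasure_iff_norm]
    intro δ hδ
    refine hfin _ ?_
    filter_upwards [hY, hR.eventually_lt_const hδ] with N hN hlt ω hω hle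
    rw [sub_zero, Real.norm_of_nonneg (hY0 N ω)] at hle
    linarith [hN ω hω]
  refine ⟨fun t => hfin _ ?_, hmeas _ (fun _ _ => IES.rowSumNorm_nonneg _) ?_,
    hmeas _ (fun _ _ => IES.rowSumNorm_nonneg _) ?_, hfin _ ?_⟩
  · filter_upwards [hgood] with N hN ω hω hn
    exact hn ((hN ω hω).1 t)
  · filter_upwards [hgood] with N hN ω hω
    exact (hN ω hω).2.1
  · filter_upwards [hgood] with N hN ω hω
    exact (hN ω hω).2.2.1
  · filter_upwards [hgood, hR.eventually_lt_const one_pos] with N hN hlt ω hω hn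
    exact hn ((hN ω hω).2.2.2 hlt)
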